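/- Let $r\ge 1$, let $\mathbb I=\{0,1,\dots,2r\}$ be the node set of the affine Dynkin diagram $A^{(1)}_{2r}$ (a cycle) with Cartan matrix $(c_{ij})$, and let $\tau$ be the diagram involution with $\tau(0)=0$ and $\tau(i)=2r+1-i$ for $1\le i\le 2r$. Let $W=\langle s_i\mid i\in\mathbb I\rangle$ be the affine Weyl group inside the extended affine Weyl group $\widetilde W=W_0\ltimes P$ of type $A_{2r}$, both regarded as acting faithfully on the affine root lattice by $s_i(\alpha_j)=\alpha_j-c_{ij}\alpha_i$ and $t_\omega(\alpha_j)=\alpha_j-\langle\omega,\alpha_j\rangle\delta$ $(\omega\in P)$. Let $W_\tau=\{w\in W\mid \tau w=w\tau\}$ be the relative affine Weyl group, with generators $\mathbf r_0,\dots,\mathbf r_r$, where $\mathbf r_0=s_0$, $\mathbf r_i=s_is_{\tau i}$ for $1\le i<r$, and $\mathbf r_r=s_rs_{r+1}s_r$. Let $\mathrm{Br}(W_\tau)=\langle t_0,\dots,t_r\rangle$ be the associated braid group (the ibraid group), defined by the braid relations of the $\mathbf r_i$: $t_it_jt_i\cdots=t_jt_it_j\cdots$ with $m_{ij}$ factors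 on each side, where $m_{ij}$ is the order of $\mathbf r_i\mathbf r_j$ (no relation if $m_{ij}=\infty$). For $1\le k\le r$ put $\varpi_k=t_{\omega_k}t_{\omega_{\tau k}}$, where $\omega_i$ are the fundamental weights. For elements $T_0,\dots,T_r$ of a group that satisfy these braid relations and $w\in W_\tau$, write $T_w=T_{i_1}\cdots T_{i_m}$ for any reduced expression $w=\mathbf r_{i_1}\cdots \mathbf r_{i_m}$ (shortest in the generators $\mathbf r_0,\dots,\mathbf r_r$); this does not depend on the reduced expression. Then for $1\le k\le r$ one has $\varpi_k\in W_\tau$ and, in $\mathrm{Br}(W_\tau)$ with $T_i=t_i$, $$T_{\varpi_k}=(T_0T_1\cdots T_{r-1}T_rT_{r-1}\cdots T_k)^k .$$ In particular $$T_{\varpi_1}=T_0T_1\cdots T_{r-1}T_rT_{r-1}\cdots T_1,\qquad T_{\varpi_r}=(T_0T_1\cdots T_r)^r,$$ and, if $r\ge 2$, also $$T_{\varpi_{r-1}}=(T_0T_1\cdots T_r)^{r-1}\,T_1T_2\cdots T_{r-1}.$$ (For $k=r$ the decreasing part $T_{r-1}\cdots T_k$ is empty.) The same identities hold for the automorphisms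 $T_i=\mathbf T_i$ of the universal affine iquantum group $\widetilde{\mathbf U}^\imath$ of type $\mathrm{AIII}_{2r}^{(\tau)}$ over $\mathbb Q(v)$, by which $\mathrm{Br}(W_\tau)$ acts on it via $t_i\mapsto\mathbf T_i$. -/

import Mathlib

noncomputable section

namespace IBraid

/-! ## The affine Dynkin diagram with involution -/

/-- The set `𝕀 = {0, 1, …, 2r}` of nodes of the affine Dynkin diagram `A_{2r}^{(1)}`
(a cycle of length `2r + 1`), with its cyclic structure. -/
abbrev Node (r : ℕ) : Type := ZMod (2 * r + 1)

/-- The Cartan matrix `(c_{ij})` of affine type `A_{2r}^{(1)}`, `r ≥ 1`. -/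
def cartan (r : ℕ) (i j : Node r) : ℤ :=
  if i = j then 2 else if i = j + 1 ∨ j = i + 1 then -1 else 0

/-- The diagram involution `τ`: it fixes `0` and sends `i` to `2r + 1 - i` for `1 ≤ i ≤ 2r`. -/
def tau (r : ℕ) (i : Node r) : Node r := -i

/-! ## The affine Weyl group, translations, and the relative affine Weyl group

The extended affine Weyl group `W₀ ⋉ P` acts faithfully on the affine root lattice `ℤ𝕀` by
`s_i(α_j) = α_j - c_{ij} α_i` and `t_ω(α_j) = α_j - ⟨ω, α_j⟩ δ`; its elements are
represented below by the corresponding automorphisms of `ℤ𝕀`. -/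

/-- The affine root lattice `ℤ𝕀`; the simple root `α_i` is `Pi.single i 1`. -/
abbrev RootLattice (r : ℕ) : Type := Node r → ℤ

/-- The simple root `α_i`. -/
def simpleRoot (r : ℕ) (i : Node r) : RootLattice r := Pi.single i 1

/-- The basic imaginary root `δ = α_0 + α_1 + ⋯ + α_{2r}`. -/
def delta (r : ℕ) : RootLattice r := ∑ i, simpleRoot r i

theorem delta_apply (r : ℕ) (j : Node r) : delta r j = 1 := by
  simp [delta, simpleRoot, Finset.sum_apply, Pi.single_apply]

/-- The functional `α_j ↦ c_{ij}` on the root lattice. -/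
def simpleCoroot (r : ℕ) (i : Node r) : Module.Dual ℤ (RootLattice r) :=
  ∑ j, cartan r i j • LinearMap.proj j

theorem simpleCoroot_simpleRoot (r : ℕ) (i j : Node r) :
    simpleCoroot r i (simpleRoot r j) = cartan r i j := by
  simp [simpleCoroot, simpleRoot, Pi.single_apply]

/-- The simple reflection `s_i`, `α_j ↦ α_j - c_{ij} α_i`. -/
def simpleReflection (r : ℕ) (i : Node r) : RootLattice r ≃ₗ[ℤ] RootLattice r :=
  Module.reflection (x := simpleRoot r i) (f := simpleCoroot r i)
    (by rw [simpleCoroot_simpleRoot]; simp [cartan])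

theorem simpleReflection_apply (r : ℕ) (i : Node r) (x : RootLattice r) :
    simpleReflection r i x = x - simpleCoroot r i x • simpleRoot r i := by
  simp [simpleReflection, Module.reflection_apply]

/-- The affine Weyl group `W = ⟨s_i ∣ i ∈ 𝕀⟩`. -/
def affineWeylGroup (r : ℕ) : Subgroup (RootLattice r ≃ₗ[ℤ] RootLattice r) :=
  Subgroup.closure (Set.range (simpleReflection r))

/-- The automorphism of the root lattice induced by the diagram involution: `α_i ↦ α_{τ i}`. -/
def tauLattice (r : ℕ) : RootLattice r ≃ₗ[ℤ] RootLattice r :=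
  LinearEquiv.funCongrLeft ℤ ℤ (Equiv.neg (Node r))

/-- The relative affine Weyl group `W_τ = {w ∈ W ∣ τ w = w τ}`. -/
def relativeWeylGroup (r : ℕ) : Subgroup (RootLattice r ≃ₗ[ℤ] RootLattice r) :=
  affineWeylGroup r ⊓ Subgroup.centralizer {tauLattice r}

/-- The weight lattice `P` of the simple Lie algebra of type `A_{2r}`: a weight `ω` is given by
its pairings `⟨ω, α_j⟩` with the simple roots, subject to `⟨ω, δ⟩ = 0` (so that the values at
`α_1, …, α_{2r}` are arbitrary integers and determine the value at `α_0 = δ - θ`). -/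
def weightLattice (r : ℕ) : Submodule ℤ (Module.Dual ℤ (RootLattice r)) :=
  LinearMap.ker (Module.Dual.eval ℤ (RootLattice r) (delta r))

/-- The functional reading off the coefficient of `α_i`. -/
def coordinate (r : ℕ) (i : Node r) : Module.Dual ℤ (RootLattice r) := LinearMap.proj i

theorem coordinate_apply (r : ℕ) (i : Node r) (x : RootLattice r) : coordinate r i x = x i := rfl

/-- The fundamental weight `ω_i`, for `i ∈ 𝕀₀ = 𝕀 ∖ {0}`: `⟨ω_i, α_j⟩` is `1` if `j = i` and `0` if
`j ∈ 𝕀₀ ∖ {i}`.  (For `i = 0` this formula gives `0`.) -/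
def fundamentalWeight (r : ℕ) (i : Node r) : weightLattice r :=
  ⟨coordinate r i - coordinate r 0, by
    rw [weightLattice, LinearMap.mem_ker, Module.Dual.eval_apply, LinearMap.sub_apply,
      coordinate_apply, coordinate_apply, delta_apply, delta_apply, sub_self]⟩

/-- The translation `t_ω`, `ω ∈ P`, acting by `β ↦ β - ⟨ω, β⟩ δ`. -/
def translation (r : ℕ) (ω : weightLattice r) : RootLattice r ≃ₗ[ℤ] RootLattice r :=
  LinearEquiv.transvection (f := -ω.1) (v := delta r) (by
    have h : ω.1 (delta r) = 0 := ω.2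
    simp [h])

theorem translation_apply (r : ℕ) (ω : weightLattice r) (x : RootLattice r) :
    translation r ω x = x - ω.1 x • delta r := by
  simp [translation, LinearMap.transvection.apply, sub_eq_add_neg]

/-- The element `ϖ_i = t_{ω_i} t_{ω_{τ i}}` of the extended affine Weyl group, `i ∈ 𝕀₀`. -/
def varpi (r : ℕ) (i : Node r) : RootLattice r ≃ₗ[ℤ] RootLattice r :=
  translation r (fundamentalWeight r i) * translation r (fundamentalWeight r (tau r i))

/-- The representative in `𝕀` of the `τ`-orbit with index `i ∈ 𝕀_τ = {0, 1, …, r}`. -/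
def rep (r : ℕ) (i : Fin (r + 1)) : Node r := ((i : ℕ) : Node r)

/-- The generators `𝐫_i` of `W_τ`, for `i ∈ 𝕀`: `s_i` if `c_{i,τi} = 2`, `s_i s_{τi}` if
`c_{i,τi} = 0`, and `s_i s_{τi} s_i` if `c_{i,τi} = -1`. -/
def relReflection (r : ℕ) (i : Node r) : RootLattice r ≃ₗ[ℤ] RootLattice r :=
  if cartan r i (tau r i) = 2 then simpleReflection r i
  else if cartan r i (tau r i) = 0 then simpleReflection r i * simpleReflection r (tau r i)
  else simpleReflection r i * simpleReflection r (tau r i) * simpleReflection r i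

/-- The word `l = (i_1, …, i_m)` in `𝕀_τ` is a reduced expression of `w`: one has
`w = 𝐫_{i_1} ⋯ 𝐫_{i_m}`, and no shorter word does this. -/
def IsReducedExpr (r : ℕ) (l : List (Fin (r + 1))) (w : RootLattice r ≃ₗ[ℤ] RootLattice r) :
    Prop :=
  (l.map fun i => relReflection r (rep r i)).prod = w ∧
    ∀ l' : List (Fin (r + 1)),
      (l'.map fun i => relReflection r (rep r i)).prod = w → l.length ≤ l'.length

/-! ## The ibraid group -/

/-- The alternating product `a b a ⋯` with `m` factors. -/
def altProd {G : Type*} [Monoid G] (a b : G) : ℕ → G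
  | 0 => 1
  | m + 1 => a * altProd b a m

/-- The braid relations `t_i t_j t_i ⋯ = t_j t_i t_j ⋯` (`m` factors on each side), where `m` is
the order of `𝐫_i 𝐫_j` in `W_τ`.  (If that order is infinite, `orderOf` is `0` and the
relation is void.) -/
def braidRelations (r : ℕ) : Set (FreeGroup (Fin (r + 1))) :=
  {x | ∃ i j : Fin (r + 1), ∃ m : ℕ,
    m = orderOf (relReflection r (rep r i) * relReflection r (rep r j)) ∧
    x = altProd (FreeGroup.of i) (FreeGroup.of j) m *
      (altProd (FreeGroup.of j) (FreeGroup.of i) m)⁻¹}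

/-- The ibraid group `Br(W_τ)`: the braid group of the relative affine Weyl group. -/
abbrev IBraidGroup (r : ℕ) : Type := PresentedGroup (braidRelations r)

/-- The generator `t_i` of the ibraid group, `i ∈ 𝕀_τ = {0, …, r}`. -/
def braidGen (r : ℕ) (i : Fin (r + 1)) : IBraidGroup r := PresentedGroup.of i

/-- `g` is the element `T_w` attached to `w` by the family `T_0, …, T_r`: the element `w` has a
reduced expression, and `g = T_{i_1} ⋯ T_{i_m}` for every reduced expression
`w = 𝐫_{i_1} ⋯ 𝐫_{i_m}`. -/
def IsLift (r : ℕ) {G : Type*} [Group G] (T : Fin (r + 1) → G)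
    (w : RootLattice r ≃ₗ[ℤ] RootLattice r) (g : G) : Prop :=
  (∃ l, IsReducedExpr r l w) ∧ ∀ l, IsReducedExpr r l w → g = (l.map T).prod

/-- The increasing product `T_a T_{a+1} ⋯ T_b`; it is `1` if `b < a`. -/
def prodUp {r : ℕ} {G : Type*} [Group G] (T : Fin (r + 1) → G) (a b : ℕ) : G :=
  (((List.finRange (r + 1)).filter fun i : Fin (r + 1) => a ≤ (i : ℕ) ∧ (i : ℕ) ≤ b).map T).prod

/-- The decreasing product `T_a T_{a-1} ⋯ T_b`; it is `1` if `a < b`. -/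
def prodDown {r : ℕ} {G : Type*} [Group G] (T : Fin (r + 1) → G) (a b : ℕ) : G :=
  (((List.finRange (r + 1)).filter fun i : Fin (r + 1) => b ≤ (i : ℕ) ∧ (i : ℕ) ≤ a).reverse.map T).prod

/-! ## The universal affine iquantum group of type `AIII_{2r}^{(τ)}` -/

/-- The field `ℚ(v)`. -/
abbrev Scalar : Type := RatFunc ℚ

/-- The indeterminate `v`. -/
def v : Scalar := RatFunc.X

/-- Symbols for the generators `B_i`, `𝕂_i`, `𝕂_i⁻¹`, `i ∈ 𝕀`. -/
inductive Gen (r : ℕ) : Type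
  | B (i : Node r) : Gen r
  | K (i : Node r) : Gen r
  | Kinv (i : Node r) : Gen r

/-- The free algebra on the generators. -/
abbrev FreeAlg (r : ℕ) : Type := FreeAlgebra Scalar (Gen r)

/-- The generator `B_i` in the free algebra. -/
def fB {r : ℕ} (i : Node r) : FreeAlg r := FreeAlgebra.ι Scalar (Gen.B i)

/-- The generator `𝕂_i` in the free algebra. -/
def fK {r : ℕ} (i : Node r) : FreeAlg r := FreeAlgebra.ι Scalar (Gen.K i)

/-- The generator `𝕂_i⁻¹` in the free algebra. -/
def fKinv {r : ℕ} (i : Node r) : FreeAlg r := FreeAlgebra.ι Scalar (Gen.Kinv i)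

/-- The expression `x² y - [2] x y x + y x²`, where `[2] = v + v⁻¹`. -/
def serre {A : Type*} [Ring A] [Algebra Scalar A] (x y : A) : A :=
  x * x * y - (v + v⁻¹) • (x * y * x) + y * x * x

/-- The defining relations of the iquantum group. (Since all entries `c_{ij}`, `i ≠ j`, are `0` or
`-1`, the Serre relations for `j ≠ τ i ≠ i` amount to commutation, contained in `comm`, and to
`serre_tau_ne`.) -/
inductive Rel (r : ℕ) : FreeAlg r → FreeAlg r → Prop
  | K_Kinv (i : Node r) : Rel r (fK i * fKinv i) 1
  | Kinv_K (i : Node r) : Rel r (fKinv i * fK i) 1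
  | K_K (i l : Node r) : Rel r (fK i * fK l) (fK l * fK i)
  | K_B (l i : Node r) : Rel r (fK l * fB i)
      (v ^ (cartan r (tau r l) i - cartan r l i) • (fB i * fK l))
  | comm (i j : Node r) (h : cartan r i j = 0) (hτ : tau r i ≠ j) :
      Rel r (fB i * fB j) (fB j * fB i)
  | serre_tau_ne (i j : Node r) (h : cartan r i j = -1) (h₁ : j ≠ tau r i) (h₂ : tau r i ≠ i) :
      Rel r (serre (fB i) (fB j)) 0
  | comm_tau (i : Node r) (h : cartan r i (tau r i) = 0) :
      Rel r (fB (tau r i) * fB i - fB i * fB (tau r i))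
        ((v - v⁻¹)⁻¹ • (fK i - fK (tau r i)))
  | serre_fixed (i j : Node r) (h : cartan r i j = -1) (hτ : cartan r i (tau r i) = 2) :
      Rel r (serre (fB i) (fB j)) (-(v⁻¹ • (fB j * fK i)))
  | serre_tau (i : Node r) (h : cartan r i (tau r i) = -1) :
      Rel r (serre (fB i) (fB (tau r i)))
        (-((v + v⁻¹) • (v • (fK i * fB i) + v • (fB i * fK (tau r i)))))

/-- The universal affine iquantum group of type `AIII_{2r}^{(τ)}`, a `ℚ(v)`-algebra. -/
abbrev IQuantumGroup (r : ℕ) : Type := RingQuot (Rel r)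

/-- The generator `B_i` of the iquantum group. -/
def genB (r : ℕ) (i : Node r) : IQuantumGroup r := RingQuot.mkAlgHom Scalar (Rel r) (fB i)

/-- The invertible generator `𝕂_i` of the iquantum group. -/
def genK (r : ℕ) (i : Node r) : (IQuantumGroup r)ˣ where
  val := RingQuot.mkAlgHom Scalar (Rel r) (fK i)
  inv := RingQuot.mkAlgHom Scalar (Rel r) (fKinv i)
  val_inv := by
    rw [← map_mul, RingQuot.mkAlgHom_rel Scalar (Rel.K_Kinv i), map_one]
  inv_val := by
    rw [← map_mul, RingQuot.mkAlgHom_rel Scalar (Rel.Kinv_K i), map_one]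

/-- The commutator `[x, y]_a = x y - a y x`. -/
def qcomm {A : Type*} [Ring A] [Algebra Scalar A] (a : Scalar) (x y : A) : A :=
  x * y - a • (y * x)

/-- The element `𝐓_i(𝕂_j)` of the iquantum group. -/
def symK (r : ℕ) (i j : Node r) : IQuantumGroup r :=
  if cartan r i (tau r i) = 2 then
    ((genK r j * genK r i ^ (-cartan r i j) : (IQuantumGroup r)ˣ) : IQuantumGroup r)
  else if cartan r i (tau r i) = 0 then
    (-v) ^ (-cartan r i j - cartan r (tau r i) j) •
      ((genK r j * genK r i ^ (-cartan r i j) * genK r (tau r i) ^ (-cartan r (tau r i) j) :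
        (IQuantumGroup r)ˣ) : IQuantumGroup r)
  else
    v ^ (-(cartan r i j + cartan r (tau r i) j)) •
      ((genK r j * (genK r i * genK r (tau r i)) ^ (-cartan r i j - cartan r (tau r i) j) :
        (IQuantumGroup r)ˣ) : IQuantumGroup r)

/-- The element `𝐓_i(B_j)` of the iquantum group when `τ i = i`. -/
def symBfixed (r : ℕ) (i j : Node r) : IQuantumGroup r :=
  if j = i then ((genK r i)⁻¹ : (IQuantumGroup r)ˣ) * genB r i
  else if cartan r i j = -1 then qcomm v (genB r j) (genB r i)
  else genB r j

/-- The element `𝐓_i(B_j)` of the iquantum group when `c_{i,τi} = 0`. -/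
def symBzero (r : ℕ) (i j : Node r) : IQuantumGroup r :=
  if j = i then -(((genK r i)⁻¹ : (IQuantumGroup r)ˣ) * genB r (tau r i))
  else if j = tau r i then -(((genK r (tau r i))⁻¹ : (IQuantumGroup r)ˣ) * genB r i)
  else if cartan r i j = -1 ∧ cartan r (tau r i) j = 0 then
    qcomm v (genB r j) (genB r i)
  else if cartan r i j = 0 ∧ cartan r (tau r i) j = -1 then
    qcomm v (genB r j) (genB r (tau r i))
  else if cartan r i j = -1 ∧ cartan r (tau r i) j = -1 then
    qcomm v (qcomm v (genB r j) (genB r i)) (genB r (tau r i)) -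
      v • (genB r j * genK r i)
  else genB r j

/-- The element `𝐓_i(B_j)` of the iquantum group when `c_{i,τi} = -1`. -/
def symBneg (r : ℕ) (i j : Node r) : IQuantumGroup r :=
  if j = i then
    -(v ^ (-2 : ℤ) • (genB r i * ((genK r (tau r i))⁻¹ : (IQuantumGroup r)ˣ)))
  else if j = tau r i then
    -(v ^ (-2 : ℤ) • (genB r (tau r i) * ((genK r i)⁻¹ : (IQuantumGroup r)ˣ)))
  else if cartan r i j = -1 ∧ cartan r (tau r i) j = 0 then
    qcomm v (qcomm v (genB r j) (genB r i)) (genB r (tau r i)) - genK r i * genB r j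
  else if cartan r i j = 0 ∧ cartan r (tau r i) j = -1 then
    qcomm v (qcomm v (genB r j) (genB r (tau r i))) (genB r i) - genK r (tau r i) * genB r j
  else if cartan r i j = -1 ∧ cartan r (tau r i) j = -1 then
    v • qcomm 1 (qcomm 1 (qcomm v (genB r j) (genB r i)) (genB r (tau r i)))
        (qcomm v (genB r (tau r i)) (genB r i)) -
      qcomm 1 (genB r j) (qcomm (v ^ 3) (genB r (tau r i)) (genB r i)) * genK r i +
      v • (genB r j * genK r i * genK r (tau r i))
  else genB r j

/-- The element `𝐓_i(B_j)` of the iquantum group. -/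
def symB (r : ℕ) (i j : Node r) : IQuantumGroup r :=
  if cartan r i (tau r i) = 2 then symBfixed r i j
  else if cartan r i (tau r i) = 0 then symBzero r i j
  else symBneg r i j

/-- The homomorphism `Φ` is the ibraid group action on the iquantum group: `Φ(t_i)` is the
automorphism `𝐓_i` with the prescribed values on the generators, for `i ∈ 𝕀_τ`. -/
def IsIBraidAction (r : ℕ)
    (Φ : IBraidGroup r →* (IQuantumGroup r ≃ₐ[Scalar] IQuantumGroup r)) : Prop :=
  ∀ (i : Fin (r + 1)) (j : Node r),
    Φ (braidGen r i) (genB r j) = symB r (rep r i) j ∧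
    Φ (braidGen r i) (genK r j : IQuantumGroup r) = symK r (rep r i) j

end IBraid

end

namespace IBraid

/-! ## Matsumoto's theorem for groups with a system of signs -/

/-! The elements of `W_τ` become permutations `f` of `ℤ` that commute with `x ↦ x + (2r + 1)` and `x
↦ 1 - x`. The link is the family `rootVec`, whose successive differences are the simple roots: up to
an additive constant, `g` acts on `rootVec r a` by `a ↦ f a`. For `i < r` the generator `𝐫_i`
exchanges `i` with `i + 1`, and `𝐫_r` exchanges `r` with `r + 2`, both extended by the two
symmetries. The class of `r + 1` is fixed, so `f` is determined by its values on the window `1, …,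
r`.

On the window the word `0, 1, …, r, r - 1, …, k` acts as an affine cycle: `x ↦ x + 1` for `x < k`,
`k ↦ 1 + (2r + 1)`, and `x ↦ x` for `x > k`. Its `k`-th power therefore adds one period to each of
`1, …, k` and fixes the rest (`permProd_varpiWord`), which is the action of `ϖ_k`
(`realizes_varpi`).

It remains to see that the `k`-th power of this word is reduced and that `T_w` is well defined. Both
follow from an abstract form of the exchange condition, `IsSignSystem`: `w` has a sign at each `i`,
recording whether `w⁻¹` keeps the relative root of `𝐫_i` positive, that is, whether its permutation
keeps `i` and `rightEnd r i` in order. Exchange (`relFun_comm`) holds because a generator reversing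
two noncentral integers must swap them. Matsumoto's theorem (`prod_eq_of_isReducedWord`) and a
letter-by-letter test for reducedness (`isReducedWord_of_posFrom`) follow.

For `k = r - 1` the second word has the same product and length as the first, so it is reduced as
well. -/

/-- A system of signs for involutions `s i` in a group `N`: `L i w` plays the role of
"`w⁻¹ α_i` is positive". -/
structure IsSignSystem {G ι : Type*} [Group G] (s : ι → G) (N : Subgroup G)
    (L : ι → G → Prop) : Prop where
  mem : ∀ i, s i ∈ N
  sq : ∀ i, s i * s i = 1
  one : ∀ i, L i 1
  anti : ∀ i, ∀ w ∈ N, L i w → ¬ L i (s i * w)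
  exchange : ∀ i j, ∀ w ∈ N, L i w → ¬ L i (w * s j) → s i * w = w * s j

/-- A word is reduced if no shorter word has the same product. -/
def IsReducedWord {G ι : Type*} [Group G] (s : ι → G) (l : List ι) : Prop :=
  ∀ l' : List ι, (l'.map s).prod = (l.map s).prod → l.length ≤ l'.length

/-- The alternating word `a b a ⋯` with `m` letters. -/
def altList {ι : Type*} (a b : ι) : ℕ → List ι
  | 0 => []
  | m + 1 => a :: altList b a m

theorem length_altList {ι : Type*} (a b : ι) (m : ℕ) : (altList a b m).length = m := by
  induction m generalizing a b with
  | zero => rfl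
  | succ m ih => simp [altList, ih]

theorem prod_map_altList {ι M : Type*} [Monoid M] (f : ι → M) (a b : ι) (m : ℕ) :
    ((altList a b m).map f).prod = altProd (f a) (f b) m := by
  induction m generalizing a b with
  | zero => rfl
  | succ m ih => simp [altList, altProd, ih]

theorem exists_altProd_succ_eq {ι M : Type*} [Monoid M] (f : ι → M) (a b : ι) (m : ℕ) :
    ∃ c, altProd (f a) (f b) (m + 1) = altProd (f a) (f b) m * f c := by
  induction m generalizing a b with
  | zero => exact ⟨a, by simp [altProd]⟩
  | succ m ih =>
    obtain ⟨c, hc⟩ := ih b a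
    exact ⟨c, by rw [altProd, hc, ← mul_assoc]; rfl⟩

/-- Hence, for involutions, the two alternating products of length `m` agree exactly when the order
of `a * b` divides `m`. -/
theorem altProd_eq_pow_mul {G : Type*} [Group G] {a b : G} (ha : a * a = 1) (hb : b * b = 1)
    (m : ℕ) : altProd a b m = (a * b) ^ m * altProd b a m := by
  induction m generalizing a b with
  | zero => simp [altProd]
  | succ m ih =>
    calc altProd a b (m + 1) = a * altProd b a m := rfl
      _ = a * ((b * a) ^ m * altProd a b m) := by rw [← ih hb ha]
      _ = (a * (b * a) ^ m) * (b * b) * altProd a b m := by rw [hb, mul_one, mul_assoc]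
      _ = (a * b) ^ (m + 1) * (b * altProd a b m) := by
        have : a * (b * a) ^ m = (a * b) ^ m * a :=
          (SemiconjBy.pow_right (by simp [SemiconjBy, mul_assoc]) m : SemiconjBy a _ _)
        rw [this, pow_succ]; simp only [mul_assoc]
      _ = _ := rfl

namespace IsSignSystem

variable {G ι : Type*} [Group G] {s : ι → G} {N : Subgroup G} {L : ι → G → Prop}

theorem prod_mem (h : IsSignSystem s N L) (l : List ι) : (l.map s).prod ∈ N :=
  N.list_prod_mem (by simpa using fun i _ => h.mem i)

/-- The exchange condition. If the sign at `i` is lost while reading `l`, it is lost at some letter;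
there `h.exchange` moves `s i` through the prefix, and it cancels that letter. -/
theorem exchange_prod (h : IsSignSystem s N L) (i : ι) (l : List ι) {x : G} (hx : x ∈ N)
    (hl : ¬ L i (x * (l.map s).prod)) : ¬ L i x ∨
      ∃ l' : List ι, l'.length + 1 = l.length ∧
        s i * (x * (l.map s).prod) = x * (l'.map s).prod := by
  induction l generalizing x with
  | nil => left; simpa using hl
  | cons j u ih =>
    rw [List.map_cons, List.prod_cons, ← mul_assoc x] at hl ⊢
    rcases ih (N.mul_mem hx (h.mem j)) hl with hj | ⟨u', hu, e⟩
    · by_cases hLx : L i x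
      · refine .inr ⟨u, rfl, ?_⟩
        rw [← mul_assoc, ← mul_assoc (s i), h.exchange i j x hx hLx hj, mul_assoc x, h.sq, mul_one]
      · exact .inl hLx
    · exact .inr ⟨j :: u', by simp [hu], by rw [e]; simp [mul_assoc]⟩

theorem sign_of_isReducedWord_cons (h : IsSignSystem s N L) {i : ι} {u : List ι}
    (hr : IsReducedWord s (i :: u)) : L i (u.map s).prod := by
  by_contra hL
  rw [← one_mul (u.map s).prod] at hL
  rcases h.exchange_prod i u N.one_mem hL with h1 | ⟨l', hl, e⟩
  · exact h1 (h.one i)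
  · have := hr l' (by simpa using e.symm)
    simp at this; omega

theorem not_sign_of_isReducedWord_cons (h : IsSignSystem s N L) {i : ι} {u : List ι}
    (hr : IsReducedWord s (i :: u)) : ¬ L i ((i :: u).map s).prod := by
  have := h.anti i _ (h.prod_mem u) (h.sign_of_isReducedWord_cons hr)
  simpa using this

theorem isReducedWord_left {l l' : List ι} (hr : IsReducedWord s (l ++ l')) :
    IsReducedWord s l := by
  intro m hm
  have := hr (m ++ l') (by simp [hm])
  simp at this; omega

theorem isReducedWord_right {l l' : List ι} (hr : IsReducedWord s (l ++ l')) :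
    IsReducedWord s l' := by
  intro m hm
  have := hr (l ++ m) (by simp [hm])
  simp at this; omega

/-- If both `i` and `j` are left descents of `w`, minimal words of `w` can be made to start with
ever longer alternating words, until the two alternating words coincide in the group. -/
theorem exists_altList_append (h : IsSignSystem s N L) {w : G} {n : ℕ}
    (hmin : ∀ l : List ι, (l.map s).prod = w → n ≤ l.length)
    (hlen : ∃ l : List ι, (l.map s).prod = w ∧ l.length = n)
    {i j : ι} (hi : ¬ L i w) (hj : ¬ L j w) (p : ℕ)
    (hp : ∀ q, 0 < q → q < p → altProd (s i) (s j) q ≠ altProd (s j) (s i) q) :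
    (∃ z, ((altList i j p ++ z).map s).prod = w ∧ (altList i j p ++ z).length = n) ∧
    (∃ z, ((altList j i p ++ z).map s).prod = w ∧ (altList j i p ++ z).length = n) := by
  induction p with
  | zero => exact ⟨hlen, hlen⟩
  | succ p ih =>
    have ih := ih fun q h0 hq => hp q h0 (by omega)
    have hpp : p = 0 ∨ altProd (s i) (s j) p ≠ altProd (s j) (s i) p :=
      (Nat.eq_zero_or_pos p).imp_right fun h0 => hp p h0 (by omega)
    have key : ∀ a b : ι, ¬ L b w → (p = 0 ∨ altProd (s a) (s b) p ≠ altProd (s b) (s a) p) →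
        (∃ z, ((altList a b p ++ z).map s).prod = w ∧ (altList a b p ++ z).length = n) →
        (∃ z, ((altList b a p ++ z).map s).prod = w ∧ (altList b a p ++ z).length = n) →
        (∃ z, ((altList b a (p + 1) ++ z).map s).prod = w ∧
          (altList b a (p + 1) ++ z).length = n) := by
      rintro a b hb hab ⟨z, hz, hzl⟩ ⟨y, hy, hyl⟩
      rw [List.map_append, List.prod_append] at hz
      rw [← hz] at hb
      rcases h.exchange_prod b z (h.prod_mem _) hb with h1 | ⟨z', hz', e⟩
      -- The sign at `b` cannot be lost inside the alternating prefix: exchange would then equate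
      -- the two alternating products of this length, against `hab`.
      · exfalso
        rcases p with _ | p
        · exact h1 (h.one b)
        have hyr : IsReducedWord s (altList b a (p + 1) ++ y) := by
          intro l hl
          rw [hyl]
          exact hmin l (hl.trans hy)
        have h2 : L b ((altList a b p).map s).prod :=
          h.sign_of_isReducedWord_cons (isReducedWord_left hyr)
        obtain ⟨c, hc⟩ := exists_altProd_succ_eq s a b p
        rw [prod_map_altList] at h1 h2
        rw [hc] at h1
        have hN : altProd (s a) (s b) p ∈ N := by
          rw [← prod_map_altList]; exact h.prod_mem _
        have h3 := h.exchange b c _ hN h2 h1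
        rcases hab with h0 | hab
        · omega
        · exact hab (by rw [hc, ← h3]; rfl)
      · refine ⟨z', ?_, ?_⟩
        · rw [hz] at e
          simp only [altList, List.cons_append, List.map_cons, List.prod_cons, List.map_append,
            List.prod_append]
          rw [← e, ← mul_assoc, h.sq, one_mul]
        · simp [length_altList] at hzl ⊢; omega
    refine ⟨key j i hi (hpp.imp_right Ne.symm) ih.2 ih.1, key i j hj hpp ih.1 ih.2⟩

/-- **Matsumoto's theorem**: two reduced words of the same element have the same product in every
monoid in which the braid relations hold. -/
theorem prod_eq_of_isReducedWord (h : IsSignSystem s N L) {M : Type*} [Monoid M] (T : ι → M)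
    (hT : ∀ i j, altProd (T i) (T j) (orderOf (s i * s j)) =
      altProd (T j) (T i) (orderOf (s i * s j)))
    {l l' : List ι} (hl : IsReducedWord s l) (hl' : IsReducedWord s l')
    (e : (l.map s).prod = (l'.map s).prod) : (l.map T).prod = (l'.map T).prod := by
  obtain ⟨n, hn⟩ : ∃ n, l.length = n := ⟨_, rfl⟩
  induction n generalizing l l' with
  | zero =>
    have : l'.length ≤ l.length := hl' l e
    have h1 : l' = [] := List.length_eq_zero_iff.1 (by omega)
    rw [h1, List.length_eq_zero_iff.1 hn]
  | succ n ih =>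
    have hlen : l.length = l'.length := le_antisymm (hl l' e.symm) (hl' l e)
    have same : ∀ (a : ι) {u u' : List ι}, IsReducedWord s (a :: u) → IsReducedWord s (a :: u') →
        ((a :: u).map s).prod = ((a :: u').map s).prod → (a :: u).length = n + 1 →
        ((a :: u).map T).prod = ((a :: u').map T).prod := by
      intro a u u' hu hu' huu hul
      rw [List.map_cons, List.prod_cons, List.map_cons, List.prod_cons,
        ih (isReducedWord_right (l := [a]) hu) (isReducedWord_right (l := [a]) hu')
          (by simpa using huu) (by simpa using hul)]
    rcases l with _ | ⟨i, u⟩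
    · simp at hn
    rcases l' with _ | ⟨j, u'⟩
    · simp at hlen
    by_cases hij : i = j
    · subst hij
      exact same i hl hl' e hn
    have hi := h.not_sign_of_isReducedWord_cons hl
    have hj := h.not_sign_of_isReducedWord_cons hl'
    rw [← e] at hj
    set w := ((i :: u).map s).prod with hw
    have hmin : ∀ l : List ι, (l.map s).prod = w → n + 1 ≤ l.length := fun m hm => hn ▸ hl m hm
    have alt := fun p => h.exists_altList_append hmin ⟨_, rfl, hn⟩ hi hj p
    have hdvd : ∀ q, altProd (s i) (s j) q = altProd (s j) (s i) q → orderOf (s i * s j) ∣ q := by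
      intro q hq
      rw [altProd_eq_pow_mul (h.sq i) (h.sq j)] at hq
      exact orderOf_dvd_of_pow_eq_one (by simpa using hq)
    set m := orderOf (s i * s j) with hm
    -- If the order were infinite (`orderOf` equal to `0`), no two alternating products of positive
    -- length would agree, and `w` would have a minimal word with a prefix longer than itself.
    have hm0 : m ≠ 0 := by
      intro h0
      obtain ⟨⟨z, -, hz⟩, -⟩ := alt (n + 2) fun q hq0 _ hq => by
        have := hdvd _ hq
        rw [h0, zero_dvd_iff] at this
        omega
      simp [length_altList] at hz
      omega
    obtain ⟨⟨z, hz, hzl⟩, -⟩ := alt m fun q hq0 hq hh =>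
      absurd (Nat.le_of_dvd hq0 (hdvd _ hh)) (by omega)
    clear_value m
    obtain ⟨m, rfl⟩ : ∃ k, m = k + 1 := ⟨m - 1, by omega⟩
    have red : ∀ x : List ι, (x.map s).prod = w → x.length = n + 1 → IsReducedWord s x :=
      fun x hx hxl t ht => hxl ▸ hmin t (ht.trans hx)
    have hsz : ((altList j i (m + 1) ++ z).map s).prod = w := by
      rw [← hz]
      simp only [List.map_append, List.prod_append, prod_map_altList]
      rw [altProd_eq_pow_mul (h.sq i) (h.sq j), hm, pow_orderOf_eq_one, one_mul]
    -- The outer steps compare words with a common first letter, by induction on length; the middle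
    -- step is a single braid relation.
    calc ((i :: u).map T).prod = ((altList i j (m + 1) ++ z).map T).prod :=
          same i hl (red _ hz hzl) (by exact hz.symm) hn
      _ = ((altList j i (m + 1) ++ z).map T).prod := by
          have := hT i j
          rw [← hm] at this
          simp only [List.map_append, List.prod_append, prod_map_altList, this]
      _ = ((j :: u').map T).prod :=
          (same j hl' (red _ hsz (by simp [length_altList] at hzl ⊢; omega))
            (by exact e.symm.trans hsz.symm) (by omega)).symm

/-- Exchange deletes letters from the left, so words are reversed: from any word for the longer
product it removes one letter and leaves a word for the inverse of the product of `l`. -/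
theorem isReducedWord_concat (h : IsSignSystem s N L) {l : List ι} (hl : IsReducedWord s l) {i : ι}
    (hi : L i ((l.map s).prod)⁻¹) : IsReducedWord s (l ++ [i]) := by
  intro l' hl'
  have inv : ∀ m : List ι, ((m.reverse).map s).prod = ((m.map s).prod)⁻¹ := by
    intro m
    induction m with
    | nil => simp
    | cons a m ih =>
      rw [List.reverse_cons, List.map_append, List.prod_append, ih]
      simp [inv_eq_of_mul_eq_one_left (h.sq a)]
  have hx := h.anti i _ (N.inv_mem (h.prod_mem l)) hi
  have e1 : s i * ((l.map s).prod)⁻¹ = 1 * ((l'.reverse).map s).prod := by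
    rw [inv, hl']
    simp [inv_eq_of_mul_eq_one_left (h.sq i)]
  rw [e1] at hx
  rcases h.exchange_prod i _ N.one_mem hx with h1 | ⟨m, hm, e⟩
  · exact absurd (h.one i) h1
  rw [← e1, ← mul_assoc, h.sq, one_mul, one_mul] at e
  have := hl m.reverse (by rw [inv, ← e, inv_inv])
  simp at this hm ⊢
  omega

end IsSignSystem

/-! ## Periodic symmetric permutations of the integers -/

theorem node_intCast_inj {r : ℕ} {x y : ℤ} (h₁ : x - y < 2 * r + 1) (h₂ : y - x < 2 * r + 1) :
    (x : Node r) = y ↔ x = y := by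
  refine ⟨fun h => ?_, fun h => by rw [h]⟩
  obtain ⟨c, hc⟩ := (ZMod.intCast_eq_intCast_iff_dvd_sub x y (2 * r + 1)).1 h
  push_cast at hc
  rcases lt_trichotomy c 0 with h0 | h0 | h0
  · nlinarith
  · subst h0; omega
  · nlinarith

theorem node_intCast_ne {r : ℕ} {x : ℤ} (h₀ : x ≠ 0) (h₁ : x < 2 * r + 1) (h₂ : -x < 2 * r + 1) :
    (x : Node r) ≠ 0 := by
  intro h
  rw [← Int.cast_zero] at h
  exact h₀ ((node_intCast_inj (by omega) (by omega)).1 h)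

theorem node_intCast_add_period (r : ℕ) (x : ℤ) : ((x + (2 * r + 1) : ℤ) : Node r) = x := by
  rw [Int.cast_add, add_eq_left]
  have : ((2 * r + 1 : ℕ) : Node r) = 0 := ZMod.natCast_self _
  exact_mod_cast this

theorem node_intCast_add_mul_period (r : ℕ) (x q : ℤ) :
    ((x + q * (2 * r + 1) : ℤ) : Node r) = x := by
  have : ((2 * r + 1 : ℕ) : Node r) = 0 := ZMod.natCast_self _
  push_cast at this ⊢
  rw [this]; ring

theorem exists_of_node_eq {r : ℕ} {x y : ℤ} (h : (x : Node r) = y) :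
    ∃ q : ℤ, x = y + q * (2 * r + 1) := by
  obtain ⟨c, hc⟩ := (ZMod.intCast_eq_intCast_iff_dvd_sub x y (2 * r + 1)).1 h
  push_cast at hc
  exact ⟨-c, by linarith⟩

/-- Maps of `ℤ` that commute with `x ↦ x + (2r + 1)` and with `x ↦ 1 - x`. -/
structure IsSymmetric (r : ℕ) (f : ℤ → ℤ) : Prop where
  add_period : ∀ x, f (x + (2 * r + 1)) = f x + (2 * r + 1)
  one_sub : ∀ x, f (1 - x) = 1 - f x

namespace IsSymmetric

variable {r : ℕ} {f g : ℤ → ℤ}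

theorem add_mul_period (hf : IsSymmetric r f) (x q : ℤ) :
    f (x + q * (2 * r + 1)) = f x + q * (2 * r + 1) := by
  induction q using Int.induction_on with
  | zero => simp
  | succ i ih =>
    have := hf.add_period (x + i * (2 * r + 1))
    rw [ih] at this
    rw [show x + ((i : ℤ) + 1) * (2 * r + 1) = x + i * (2 * r + 1) + (2 * r + 1) by ring, this]
    ring
  | pred i ih =>
    have := hf.add_period (x + (-i - 1) * (2 * r + 1))
    rw [show x + (-(i : ℤ) - 1) * (2 * r + 1) + (2 * r + 1) = x + -i * (2 * r + 1) by ring, ih]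
      at this
    linarith

theorem id (r : ℕ) : IsSymmetric r id := ⟨fun _ => rfl, fun _ => rfl⟩

theorem comp (hf : IsSymmetric r f) (hg : IsSymmetric r g) : IsSymmetric r (f ∘ g) :=
  ⟨fun x => by simp [hg.add_period, hf.add_period], fun x => by simp [hg.one_sub, hf.one_sub]⟩

theorem apply_center (hf : IsSymmetric r f) : f (r + 1) = r + 1 := by
  have h1 := hf.one_sub (r + 1)
  have h2 := hf.add_period (-r)
  rw [show (-(r : ℤ) + (2 * r + 1)) = r + 1 by ring] at h2
  rw [show (1 - ((r : ℤ) + 1)) = -r by ring] at h1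
  omega

/-- The map `x ↦ 1 - x` followed by one period carries `1, …, r` to `r + 2, …, 2r + 1`, and `r + 1`
is fixed, so the window determines a full period. -/
theorem ext_window (hf : IsSymmetric r f) (hg : IsSymmetric r g)
    (h : ∀ x : ℤ, 1 ≤ x → x ≤ r → f x = g x) : f = g := by
  have h1 : ∀ x : ℤ, 1 ≤ x → x ≤ 2 * r + 1 → f x = g x := by
    intro x hx hx'
    rcases lt_trichotomy x (r + 1) with hlt | rfl | hgt
    · exact h x hx (by omega)
    · rw [hf.apply_center, hg.apply_center]
    · have h3 := h (1 - (x - (2 * r + 1))) (by omega) (by omega)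
      have hf1 := hf.one_sub (x - (2 * r + 1))
      have hg1 := hg.one_sub (x - (2 * r + 1))
      have hf2 := hf.add_period (x - (2 * r + 1))
      have hg2 := hg.add_period (x - (2 * r + 1))
      rw [sub_add_cancel] at hf2 hg2
      omega
  ext x
  have e : x = (x - 1) % (2 * r + 1) + 1 + (x - 1) / (2 * r + 1) * (2 * r + 1) := by
    have := Int.emod_add_mul_ediv (x - 1) (2 * r + 1)
    linarith
  have b1 := Int.emod_nonneg (x - 1) (show (2 * r + 1 : ℤ) ≠ 0 by omega)
  have b2 := Int.emod_lt_of_pos (x - 1) (show (0 : ℤ) < 2 * r + 1 by omega)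
  rw [e, hf.add_mul_period, hg.add_mul_period, h1 _ (by omega) (by omega)]

theorem noncenter_apply (hf : IsSymmetric r f) (hi : Function.Injective f) {x : ℤ}
    (hx : (x : Node r) ≠ (r : Node r) + 1) : (f x : Node r) ≠ (r : Node r) + 1 := by
  intro h
  have h' : (f x : Node r) = ((r + 1 : ℤ) : Node r) := by push_cast; exact h
  obtain ⟨q, hq⟩ := exists_of_node_eq h'
  rw [← hf.apply_center, ← hf.add_mul_period] at hq
  apply hx
  rw [hi hq, node_intCast_add_mul_period]
  push_cast; rfl

end IsSymmetric

/-- The permutation of `ℤ` corresponding to the simple reflection `s_i`. -/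
def nodeSwap (r : ℕ) (i : Node r) (x : ℤ) : ℤ :=
  if (x : Node r) = i then x + 1 else if (x : Node r) = i + 1 then x - 1 else x

/-- The permutation of `ℤ` corresponding to `𝐫_i`, `0 ≤ i ≤ r`. -/
def relFun (r i : ℕ) (x : ℤ) : ℤ :=
  if i < r then
    if (x : Node r) = i ∨ (x : Node r) = -i then x + 1
    else if (x : Node r) = i + 1 ∨ (x : Node r) = 1 - i then x - 1 else x
  else
    if (x : Node r) = r then x + 2 else if (x : Node r) = r + 2 then x - 2 else x

theorem node_two_mul_r (r : ℕ) : (2 * r + 1 : Node r) = 0 := by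
  have : ((2 * r + 1 : ℕ) : Node r) = 0 := ZMod.natCast_self _
  exact_mod_cast this

theorem node_one_ne {r : ℕ} (hr : 1 ≤ r) : (1 : Node r) ≠ 0 := by
  have := node_intCast_ne (r := r) (x := 1) (by omega) (by omega) (by omega)
  simpa using this

theorem node_two_ne {r : ℕ} (hr : 1 ≤ r) : (2 : Node r) ≠ 0 := by
  have := node_intCast_ne (r := r) (x := 2) (by omega) (by omega) (by omega)
  simpa using this

/-- This and the next two facts separate the residues `i`, `i + 1` from `-i`, `1 - i` when `1 ≤ i <
r`, so that the two transpositions making up `𝐫_i` are disjoint. -/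
theorem node_two_mul_ne {r i : ℕ} (h0 : 1 ≤ i) (hi : i ≤ r) : (2 * i : Node r) ≠ 0 := by
  have := node_intCast_ne (r := r) (x := 2 * i) (by omega) (by omega) (by omega)
  simpa using this

theorem node_two_mul_add_one_ne {r i : ℕ} (hi : i < r) : (2 * i + 1 : Node r) ≠ 0 := by
  have := node_intCast_ne (r := r) (x := 2 * i + 1) (by omega) (by omega) (by omega)
  simpa using this

theorem node_two_mul_sub_one_ne {r i : ℕ} (h0 : 1 ≤ r) (hi : i < r) : (2 * i - 1 : Node r) ≠ 0 := by
  have := node_intCast_ne (r := r) (x := 2 * i - 1) (by omega) (by omega) (by omega)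
  simpa using this

theorem nodeSwap_cast (r : ℕ) (i : Node r) (x : ℤ) : (nodeSwap r i x : Node r) =
    if (x : Node r) = i then (x : Node r) + 1
    else if (x : Node r) = i + 1 then (x : Node r) - 1 else x := by
  unfold nodeSwap
  split_ifs <;> push_cast <;> rfl

theorem relFun_cast (r i : ℕ) (x : ℤ) : (relFun r i x : Node r) =
    if i < r then
      if (x : Node r) = i ∨ (x : Node r) = -i then (x : Node r) + 1
      else if (x : Node r) = i + 1 ∨ (x : Node r) = 1 - i then (x : Node r) - 1 else x
    else
      if (x : Node r) = r then (x : Node r) + 2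
      else if (x : Node r) = r + 2 then (x : Node r) - 2 else x := by
  unfold relFun
  split_ifs <;> push_cast <;> rfl

theorem relFun_zero {r : ℕ} (hr : 1 ≤ r) (x : ℤ) : relFun r 0 x = nodeSwap r 0 x := by
  have : 0 < r := hr
  simp [relFun, nodeSwap, this]

theorem relFun_of_lt {r i : ℕ} (h0 : 1 ≤ i) (hi : i < r) (x : ℤ) :
    relFun r i x = nodeSwap r i (nodeSwap r (-i) x) := by
  have h1 := node_one_ne (r := r) (by omega)
  have h2 := node_two_mul_ne h0 hi.le
  have h3 := node_two_mul_add_one_ne hi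
  have h5 := node_two_mul_sub_one_ne (r := r) (by omega) hi
  have h6 := node_two_ne (r := r) (by omega)
  have c := nodeSwap_cast r (-i) x
  obtain ⟨y, hy⟩ : ∃ y, nodeSwap r (-i) x = y := ⟨_, rfl⟩
  rw [hy] at c ⊢
  simp only [relFun, nodeSwap, hi, if_true] at hy ⊢
  grind

theorem relFun_self {r : ℕ} (hr : 1 ≤ r) (x : ℤ) :
    relFun r r x = nodeSwap r r (nodeSwap r (-r) (nodeSwap r r x)) := by
  have h1 := node_one_ne hr
  have h2 := node_two_mul_ne hr le_rfl
  have h3 := node_two_mul_r r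
  have h6 := node_two_ne hr
  have c := nodeSwap_cast r r x
  obtain ⟨y, hy⟩ : ∃ y, nodeSwap r r x = y := ⟨_, rfl⟩
  rw [hy] at c ⊢
  have d := nodeSwap_cast r (-r) y
  obtain ⟨z, hz⟩ : ∃ z, nodeSwap r (-r) y = z := ⟨_, rfl⟩
  rw [hz] at d ⊢
  simp only [relFun, nodeSwap, lt_irrefl, if_false] at hy hz ⊢
  grind

theorem relFun_involutive {r i : ℕ} (hr : 1 ≤ r) (hi : i ≤ r) :
    Function.Involutive (relFun r i) := by
  intro x
  have h1 := node_one_ne hr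
  have h6 := node_two_ne hr
  have c := relFun_cast r i x
  obtain ⟨y, hy⟩ : ∃ y, relFun r i x = y := ⟨_, rfl⟩
  rw [hy] at c ⊢
  rcases hi.lt_or_eq with hi | rfl
  · have h3 := node_two_mul_add_one_ne hi
    have h5 := node_two_mul_sub_one_ne (r := r) (by omega) hi
    simp only [relFun, hi, if_true] at c hy ⊢
    grind
  · simp only [relFun, lt_irrefl, if_false] at c hy ⊢
    by_cases e1 : (x : Node i) = i
    · rw [if_pos e1] at c hy
      rw [e1] at c
      rw [if_neg (by rw [c]; simpa using h6), if_pos c]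
      omega
    · rw [if_neg e1] at c hy
      by_cases e2 : (x : Node i) = i + 2
      · rw [if_pos e2] at c hy
        rw [if_pos (by rw [c, e2]; ring)]
        omega
      · rw [if_neg e2] at c hy
        rw [if_neg (by rwa [c]), if_neg (by rwa [c]), hy]

theorem relFun_isSymmetric {r i : ℕ} (hr : 1 ≤ r) (hi : i ≤ r) : IsSymmetric r (relFun r i) := by
  have h1 := node_one_ne hr
  have h6 := node_two_ne hr
  refine ⟨fun x => ?_, fun x => ?_⟩
  · simp only [relFun, node_intCast_add_period]
    grind
  · rcases hi.lt_or_eq with hi | rfl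
    · have h3 := node_two_mul_add_one_ne hi
      have h5 := node_two_mul_sub_one_ne (r := r) (by omega) hi
      simp only [relFun, hi, if_true]
      push_cast
      grind
    · have h3 := node_two_mul_r i
      simp only [relFun, lt_irrefl, if_false]
      push_cast
      grind

/-- The central class must be excluded because the exchange of `r` and `r + 2` also reverses the
pairs `r, r + 1` and `r + 1, r + 2`. -/
theorem relFun_flip {r j : ℕ} (hr : 1 ≤ r) (hj : j ≤ r) {x y : ℤ} (hxy : x < y)
    (hx : (x : Node r) ≠ (r : Node r) + 1) (hy : (y : Node r) ≠ (r : Node r) + 1)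
    (h : relFun r j y ≤ relFun r j x) : relFun r j x = y ∧ relFun r j y = x := by
  have h1 := node_one_ne hr
  have h6 := node_two_ne hr
  rcases hj.lt_or_eq with hj | rfl
  · have h3 := node_two_mul_add_one_ne hj
    have h5 := node_two_mul_sub_one_ne (r := r) (by omega) hj
    simp only [relFun, hj, if_true] at h ⊢
    have : y = x + 1 ∨ y = x + 2 := by grind
    rcases this with rfl | rfl <;> grind
  · have h3 := node_two_mul_r j
    simp only [relFun, lt_irrefl, if_false] at h ⊢
    -- Each point moves by at most `2`, so a reversal forces `y - x ≤ 4`.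
    have : y = x + 1 ∨ y = x + 2 ∨ y = x + 3 ∨ y = x + 4 := by grind
    rcases this with rfl | rfl | rfl | rfl <;> grind

/-- The moved points form one orbit under period shifts, `x ↦ 1 - x` and the generator itself, so
one moved pair controls the whole generator. -/
theorem relFun_moved {r j : ℕ} (hr : 1 ≤ r) (hj : j ≤ r) {x z : ℤ} (hx : relFun r j x ≠ x)
    (hz : relFun r j z ≠ z) :
    ((z : Node r) = x ∨ (z : Node r) = 1 - x) ∨
      ((z : Node r) = relFun r j x ∨ (z : Node r) = 1 - relFun r j x) := by
  rw [relFun_cast]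
  rcases hj.lt_or_eq with hj | rfl
  · simp only [relFun, hj, if_true] at hx hz ⊢
    grind
  · have h3 := node_two_mul_r j
    simp only [relFun, lt_irrefl, if_false] at hx hz ⊢
    grind

/-! ## Realizing automorphisms of the root lattice by permutations of the integers -/

/-- The vectors with `rootVec 0 = 0` and `rootVec (a + 1) - rootVec a = α_a`, indices modulo
`2r + 1`. -/
def rootVec (r : ℕ) (a : ℤ) : RootLattice r := fun j => -(((j.val : ℤ) - a) / (2 * r + 1))

theorem node_val_cast (r : ℕ) (j : Node r) : ((j.val : ℤ) : Node r) = j := by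
  simp

theorem rootVec_add_one (r : ℕ) (a : ℤ) :
    rootVec r (a + 1) = rootVec r a + simpleRoot r (a : Node r) := by
  ext j
  have hn : (0 : ℤ) < 2 * r + 1 := by omega
  have hd : j = (a : Node r) ↔ (2 * r + 1 : ℤ) ∣ (j.val : ℤ) - a := by
    conv_lhs => rw [← node_val_cast r j, eq_comm]
    rw [ZMod.intCast_eq_intCast_iff_dvd_sub]
    push_cast
    rfl
  simp only [rootVec, Pi.add_apply, simpleRoot, Pi.single_apply, hd]
  have e := Int.emod_add_mul_ediv ((j.val : ℤ) - a) (2 * r + 1)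
  have b1 := Int.emod_nonneg ((j.val : ℤ) - a) hn.ne'
  have b2 := Int.emod_lt_of_pos ((j.val : ℤ) - a) hn
  set q := ((j.val : ℤ) - a) / (2 * r + 1)
  set m := ((j.val : ℤ) - a) % (2 * r + 1) with hm
  -- The floor quotient drops by one exactly when `2r + 1` divides `j.val - a`.
  split_ifs with h
  · have hm0 : m = 0 := Int.emod_eq_zero_of_dvd h
    have : ((j.val : ℤ) - (a + 1)) / (2 * r + 1) = q - 1 :=
      ((Int.ediv_emod_unique (r := 2 * r) hn).2 ⟨by linarith, by omega, by omega⟩).1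
    rw [this]; ring
  · have hm0 : m ≠ 0 := fun h0 => h (Int.dvd_of_emod_eq_zero h0)
    have : ((j.val : ℤ) - (a + 1)) / (2 * r + 1) = q :=
      ((Int.ediv_emod_unique (r := m - 1) hn).2 ⟨by linarith, by omega, by omega⟩).1
    rw [this]; ring

theorem rootVec_add_period (r : ℕ) (a : ℤ) :
    rootVec r (a + (2 * r + 1)) = rootVec r a + delta r := by
  ext j
  have hn : (2 * r + 1 : ℤ) ≠ 0 := by omega
  rw [Pi.add_apply, delta_apply]
  simp only [rootVec]
  rw [show (j.val : ℤ) - (a + (2 * r + 1)) = (j.val : ℤ) - a + (-1) * (2 * r + 1) by ring,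
    Int.add_mul_ediv_right _ _ hn]
  ring

theorem rootVec_add_mul_period (r : ℕ) (a q : ℤ) :
    rootVec r (a + q * (2 * r + 1)) = rootVec r a + q • delta r := by
  ext j
  have hn : (2 * r + 1 : ℤ) ≠ 0 := by omega
  rw [Pi.add_apply, Pi.smul_apply, delta_apply]
  simp only [rootVec]
  rw [show (j.val : ℤ) - (a + q * (2 * r + 1)) = (j.val : ℤ) - a + (-q) * (2 * r + 1) by ring,
    Int.add_mul_ediv_right _ _ hn]
  simp; ring

theorem rootVec_mono (r : ℕ) : Monotone (rootVec r) := by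
  refine monotone_int_of_le_succ fun a => ?_
  rw [rootVec_add_one, le_add_iff_nonneg_right, simpleRoot, Pi.single_nonneg]
  exact zero_le_one

/-- This turns positivity of vectors in the root lattice into order of integers. -/
theorem rootVec_le_iff (r : ℕ) {a b : ℤ} : rootVec r a ≤ rootVec r b ↔ a ≤ b := by
  refine ⟨fun h => ?_, fun h => rootVec_mono r h⟩
  by_contra! hlt
  have h1 : rootVec r (b + 1) ≤ rootVec r b := (rootVec_mono r hlt).trans h
  rw [rootVec_add_one, add_le_iff_nonpos_right] at h1
  have := h1 b
  simp [simpleRoot] at this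

theorem eq_add_const_of_step {M : Type*} [AddCommGroup M] {F G : ℤ → M}
    (h : ∀ a, F (a + 1) - F a = G (a + 1) - G a) : ∃ c, ∀ a, F a = G a + c := by
  refine ⟨F 0 - G 0, fun a => ?_⟩
  induction a using Int.induction_on with
  | zero => abel
  | succ i ih =>
    have h1 := h i
    rw [ih] at h1
    have : F (i + 1) = (F (i + 1) - (G i + (F 0 - G 0))) + (G i + (F 0 - G 0)) := by abel
    rw [this, h1]; abel
  | pred i ih =>
    have h1 := h (-i - 1)
    rw [sub_add_cancel, ih] at h1
    have : F (-i - 1) = (G (-i) + (F 0 - G 0)) - (G (-i) + (F 0 - G 0) - F (-i - 1)) := by abel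
    rw [this, h1]; abel

/-- The map `f` of `ℤ` realizes the automorphism `g` of the root lattice. -/
def Realizes (r : ℕ) (f : ℤ → ℤ) (g : RootLattice r ≃ₗ[ℤ] RootLattice r) : Prop :=
  ∃ c, ∀ a, g (rootVec r a) = rootVec r (f a) + c

namespace Realizes

variable {r : ℕ} {f f' : ℤ → ℤ} {g g' : RootLattice r ≃ₗ[ℤ] RootLattice r}

theorem one (r : ℕ) : Realizes r id 1 := ⟨0, fun a => by simp⟩

theorem mul (h : Realizes r f g) (h' : Realizes r f' g') : Realizes r (f ∘ f') (g * g') := by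
  obtain ⟨c, hc⟩ := h
  obtain ⟨c', hc'⟩ := h'
  exact ⟨c + g c', fun a => by
    rw [LinearEquiv.mul_apply, hc', map_add, hc, Function.comp_apply, add_assoc]⟩

theorem inv {f : Equiv.Perm ℤ} (h : Realizes r f g) : Realizes r (f⁻¹ : Equiv.Perm ℤ) g⁻¹ := by
  obtain ⟨c, hc⟩ := h
  refine ⟨-(g⁻¹ c), fun a => ?_⟩
  apply g.injective
  have hg : ∀ x, g (g⁻¹ x) = x := fun x => g.apply_symm_apply x
  rw [map_add, map_neg, hg, hg, hc]
  simp

theorem apply_sub (h : Realizes r f g) (a b : ℤ) :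
    g (rootVec r b - rootVec r a) = rootVec r (f b) - rootVec r (f a) := by
  obtain ⟨c, hc⟩ := h
  rw [map_sub, hc, hc]; abel

theorem of_step (h : ∀ a : ℤ, g (simpleRoot r (a : Node r)) =
    rootVec r (f (a + 1)) - rootVec r (f a)) : Realizes r f g := by
  refine eq_add_const_of_step fun a => ?_
  rw [← h, rootVec_add_one, map_add]; abel

/-- The additive constants cancel in differences of the `rootVec`, and these differences include the
basis of simple roots. -/
theorem eq (h : Realizes r f g) (h' : Realizes r f g') : g = g' := by
  apply LinearEquiv.toLinearMap_injective
  refine (Pi.basisFun ℤ (Node r)).ext fun j => ?_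
  have e : (Pi.basisFun ℤ (Node r)) j = rootVec r (j.val + 1) - rootVec r j.val := by
    rw [rootVec_add_one, node_val_cast, add_sub_cancel_left, Pi.basisFun_apply]
    rfl
  rw [e, LinearEquiv.coe_coe, LinearEquiv.coe_coe, h.apply_sub, h'.apply_sub]

end Realizes

/-! ### Simple reflections and the generators `𝐫_i` as permutations of `ℤ`. -/

theorem simpleReflection_simpleRoot (r : ℕ) (i j : Node r) :
    simpleReflection r i (simpleRoot r j) = simpleRoot r j - cartan r i j • simpleRoot r i := by
  rw [simpleReflection_apply, simpleCoroot_simpleRoot]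

theorem realizes_simpleReflection {r : ℕ} (hr : 1 ≤ r) (i : Node r) :
    Realizes r (nodeSwap r i) (simpleReflection r i) := by
  have h1 := node_one_ne hr
  have h2 := node_two_ne hr
  refine .of_step fun a => ?_
  rw [simpleReflection_simpleRoot]
  have e1 := rootVec_add_one r a
  have e2 := rootVec_add_one r (a + 1)
  have e3 := rootVec_add_one r (a - 1)
  rw [sub_add_cancel] at e3
  by_cases c1 : (a : Node r) = i
  · subst c1
    have : nodeSwap r a (a + 1) = a := by simp [nodeSwap, h1]
    have h' : nodeSwap r a a = a + 1 := by simp [nodeSwap]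
    rw [this, h', e1, cartan, if_pos rfl]
    module
  by_cases c2 : (a : Node r) + 1 = i
  · subst c2
    have : nodeSwap r (a + 1) (a + 1) = a + 1 + 1 := by simp [nodeSwap]
    have h' : nodeSwap r (a + 1) a = a := by
      have : (a : Node r) ≠ a + 1 + 1 := by
        rw [add_assoc]; simpa [one_add_one_eq_two] using h2
      simp [nodeSwap, h1, this]
    rw [this, h', e2, e1, cartan, if_neg (Ne.symm c1), if_pos (.inl rfl)]
    push_cast
    module
  by_cases c3 : (a : Node r) = i + 1
  · obtain rfl : i = a - 1 := by rw [c3]; ring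
    have : nodeSwap r (a - 1) (a + 1) = a + 1 := by
      have : (a : Node r) + 1 ≠ a - 1 := fun h => h2 (by linear_combination h)
      simp [nodeSwap, h1, this]
    have h' : nodeSwap r (a - 1) a = a - 1 := by
      have : (a : Node r) ≠ a - 1 := fun h => h1 (by linear_combination h)
      simp [nodeSwap, this]
    rw [this, h', e1, cartan, if_neg (Ne.symm c1), if_pos (.inr c3)]
    nth_rewrite 1 [e3]
    push_cast
    module
  · have : nodeSwap r i (a + 1) = a + 1 := by
      have : ¬ (a : Node r) + 1 = i + 1 := fun h => c1 (by linear_combination h)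
      simp [nodeSwap, c2, c1]
    have h' : nodeSwap r i a = a := by
      simp [nodeSwap, c1, c3]
    rw [this, h', e1, cartan, if_neg (Ne.symm c1), if_neg (by
      rintro (h | h)
      · exact c2 h.symm
      · exact c3 h)]
    simp

theorem relReflection_zero (r : ℕ) : relReflection r ((0 : ℕ) : Node r) = simpleReflection r 0 := by
  simp [relReflection, cartan, tau]

theorem relReflection_of_lt {r i : ℕ} (h0 : 1 ≤ i) (hi : i < r) :
    relReflection r (i : Node r) = simpleReflection r i * simpleReflection r (-i) := by
  have h2 := node_two_mul_ne h0 hi.le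
  have h3 := node_two_mul_add_one_ne hi
  have h5 := node_two_mul_sub_one_ne (r := r) (by omega) hi
  have c1 : ¬ (i : Node r) = -i := fun h => h2 (by linear_combination h)
  have c2 : ¬ (i : Node r) = -i + 1 := fun h => h5 (by linear_combination h)
  have c3 : ¬ (-i : Node r) = i + 1 := fun h => h3 (by linear_combination -h)
  simp [relReflection, cartan, tau, c1, c2, c3]

theorem relReflection_self {r : ℕ} (hr : 1 ≤ r) : relReflection r (r : Node r) =
    simpleReflection r r * simpleReflection r (-r) * simpleReflection r r := by
  have h2 := node_two_mul_ne hr le_rfl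
  have h3 := node_two_mul_r r
  have c1 : ¬ (r : Node r) = -r := fun h => h2 (by linear_combination h)
  have c3 : (-r : Node r) = r + 1 := by linear_combination -h3
  have c : cartan r (r : Node r) (tau r r) = -1 := by
    rw [cartan, tau, if_neg c1, if_pos (.inr c3)]
  rw [relReflection, c]
  simp [tau]

theorem realizes_relReflection {r i : ℕ} (hr : 1 ≤ r) (hi : i ≤ r) :
    Realizes r (relFun r i) (relReflection r (i : Node r)) := by
  rcases hi.lt_or_eq with hi | rfl
  · rcases Nat.eq_zero_or_pos i with rfl | h0
    · rw [relReflection_zero, funext (relFun_zero hr)]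
      exact realizes_simpleReflection hr 0
    · rw [relReflection_of_lt h0 hi, funext (relFun_of_lt h0 hi)]
      exact (realizes_simpleReflection hr _).mul (realizes_simpleReflection hr _)
  · rw [relReflection_self hr, funext (relFun_self hr)]
    exact ((realizes_simpleReflection hr _).mul (realizes_simpleReflection hr _)).mul
      (realizes_simpleReflection hr _)

theorem relReflection_mem_affineWeylGroup (r : ℕ) (i : Node r) :
    relReflection r i ∈ affineWeylGroup r := by
  have h : ∀ j, simpleReflection r j ∈ affineWeylGroup r :=
    fun j => Subgroup.subset_closure ⟨j, rfl⟩
  unfold relReflection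
  split_ifs
  · exact h _
  · exact mul_mem (h _) (h _)
  · exact mul_mem (mul_mem (h _) (h _)) (h _)

/-! ## The sign system of the relative affine Weyl group -/

/-- The right end of the interval `[i, b]` of integers attached to `𝐫_i`. -/
def rightEnd (r i : ℕ) : ℤ := if i < r then i + 1 else r + 2

theorem lt_rightEnd {r i : ℕ} (hi : i ≤ r) : (i : ℤ) < rightEnd r i := by
  unfold rightEnd; split_ifs <;> omega

theorem relFun_left {r i : ℕ} (hi : i ≤ r) : relFun r i i = rightEnd r i := by
  rcases hi.lt_or_eq with h | rfl
  · simp [relFun, rightEnd, h]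
  · simp [relFun, rightEnd]

theorem relFun_right {r i : ℕ} (hr : 1 ≤ r) (hi : i ≤ r) : relFun r i (rightEnd r i) = i := by
  rw [← relFun_left hi, relFun_involutive hr hi]

theorem noncenter_left {r i : ℕ} (hr : 1 ≤ r) (hi : i ≤ r) :
    ((i : ℤ) : Node r) ≠ (r : Node r) + 1 := by
  have := (node_intCast_inj (r := r) (x := i) (y := r + 1) (by omega) (by omega)).not.2 (by omega)
  simpa using this

theorem noncenter_right {r : ℕ} (i : ℕ) (hr : 1 ≤ r) :
    (rightEnd r i : Node r) ≠ (r : Node r) + 1 := by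
  have h1 : rightEnd r i = i + 1 ∧ i < r ∨ rightEnd r i = r + 2 := by
    unfold rightEnd; split_ifs <;> simp [*]
  have := (node_intCast_inj (r := r) (x := rightEnd r i) (y := r + 1) (by omega) (by omega)).not.2
    (by omega)
  simpa using this

/-- By `relFun_flip` the generator `j` swaps `f i` and `f (rightEnd r i)`. The symmetries of `f`
spread this to the whole orbit of the pair, and by `relFun_moved` neither side moves anything else.
-/
theorem relFun_comm {r i j : ℕ} (hr : 1 ≤ r) (hi : i ≤ r) (hj : j ≤ r) {f : Equiv.Perm ℤ}
    (hf : IsSymmetric r f) (hlt : f i < f (rightEnd r i))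
    (h : relFun r j (f (rightEnd r i)) ≤ relFun r j (f i)) :
    f ∘ relFun r i = relFun r j ∘ f := by
  obtain ⟨e1, e2⟩ := relFun_flip hr hj hlt (hf.noncenter_apply f.injective (noncenter_left hr hi))
    (hf.noncenter_apply f.injective (noncenter_right i hr)) h
  have si := relFun_isSymmetric hr hi
  have sj := relFun_isSymmetric hr hj
  have orb : ∀ x y z : ℤ, relFun r i x = y → relFun r j (f x) = f y →
      ((z : Node r) = x ∨ (z : Node r) = 1 - x) → f (relFun r i z) = relFun r j (f z) := by
    rintro x y z hx hy (hz | hz)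
    · obtain ⟨q, rfl⟩ := exists_of_node_eq hz
      rw [si.add_mul_period, hf.add_mul_period, hf.add_mul_period, sj.add_mul_period, hx, hy]
    · obtain ⟨q, rfl⟩ := exists_of_node_eq (x := z) (y := 1 - x) (by simpa using hz)
      rw [si.add_mul_period, hf.add_mul_period, hf.add_mul_period, sj.add_mul_period,
        si.one_sub, hf.one_sub, hf.one_sub, sj.one_sub, hx, hy]
  have orb' : ∀ x z : ℤ, ((f z : Node r) = f x ∨ (f z : Node r) = 1 - f x) →
      ((z : Node r) = x ∨ (z : Node r) = 1 - x) := by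
    rintro x z (hz | hz)
    · obtain ⟨q, hq⟩ := exists_of_node_eq hz
      rw [← hf.add_mul_period] at hq
      left
      rw [f.injective hq]
      exact node_intCast_add_mul_period r x q
    · obtain ⟨q, hq⟩ := exists_of_node_eq (x := f z) (y := 1 - f x) (by simpa using hz)
      rw [← hf.one_sub, ← hf.add_mul_period] at hq
      right
      rw [f.injective hq]
      rw [node_intCast_add_mul_period]; simp
  ext z
  by_cases h1 : relFun r i z = z
  · by_cases h2 : relFun r j (f z) = f z
    · simp [h1, h2]
    · have h3 : relFun r j (f i) ≠ f i := by rw [e1]; exact hlt.ne'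
      have := relFun_moved hr hj h3 h2
      rw [e1] at this
      rcases this with h4 | h4
      · exact orb _ _ z (relFun_left hi) e1 (orb' _ _ h4)
      · exact orb _ _ z (relFun_right hr hi) e2 (orb' _ _ h4)
  · have h3 : relFun r i i ≠ i := by rw [relFun_left hi]; exact (lt_rightEnd hi).ne'
    have := relFun_moved hr hi h3 h1
    rw [relFun_left hi] at this
    rcases this with h4 | h4
    · exact orb _ _ z (relFun_left hi) e1 h4
    · exact orb _ _ z (relFun_right hr hi) e2 h4

/-- The automorphisms of the root lattice realized by symmetric periodic permutations of `ℤ`. -/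
def realizable (r : ℕ) : Subgroup (RootLattice r ≃ₗ[ℤ] RootLattice r) where
  carrier := {g | ∃ f : Equiv.Perm ℤ, IsSymmetric r f ∧ Realizes r f g}
  one_mem' := ⟨1, IsSymmetric.id r, Realizes.one r⟩
  mul_mem' := by
    rintro _ _ ⟨f, hf, h⟩ ⟨f', hf', h'⟩
    exact ⟨f * f', hf.comp hf', h.mul h'⟩
  inv_mem' := by
    rintro _ ⟨f, hf, h⟩
    refine ⟨f⁻¹, ⟨fun x => ?_, fun x => ?_⟩, h.inv⟩
    · apply f.injective
      rw [hf.add_period]; simp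
    · apply f.injective
      rw [hf.one_sub]; simp

/-- The permutation of `ℤ` realizing `𝐫_i`. -/
def relPerm {r : ℕ} (hr : 1 ≤ r) (i : Fin (r + 1)) : Equiv.Perm ℤ :=
  (relFun_involutive hr (Nat.lt_succ_iff.1 i.2)).toPerm

theorem relPerm_apply {r : ℕ} (hr : 1 ≤ r) (i : Fin (r + 1)) (x : ℤ) :
    relPerm hr i x = relFun r i x := rfl

theorem relPerm_isSymmetric {r : ℕ} (hr : 1 ≤ r) (i : Fin (r + 1)) :
    IsSymmetric r (relPerm hr i) :=
  relFun_isSymmetric hr (Nat.lt_succ_iff.1 i.2)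

theorem realizes_relPerm {r : ℕ} (hr : 1 ≤ r) (i : Fin (r + 1)) :
    Realizes r (relPerm hr i) (relReflection r (rep r i)) :=
  realizes_relReflection hr (Nat.lt_succ_iff.1 i.2)

/-- The element `w` sends the relative root of `𝐫_i` to a positive vector. -/
def IsPos (r : ℕ) (i : Fin (r + 1)) (w : RootLattice r ≃ₗ[ℤ] RootLattice r) : Prop :=
  0 ≤ w (rootVec r (rightEnd r i) - rootVec r (i : ℕ))

theorem Realizes.isPos_iff {r : ℕ} {i : Fin (r + 1)} {f : Equiv.Perm ℤ}
    {w : RootLattice r ≃ₗ[ℤ] RootLattice r} (h : Realizes r f w) :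
    IsPos r i w ↔ f (i : ℕ) < f (rightEnd r i) := by
  rw [IsPos, h.apply_sub, sub_nonneg, rootVec_le_iff, le_iff_lt_or_eq, or_iff_left]
  exact fun e => (lt_rightEnd (Nat.lt_succ_iff.1 i.2)).ne (f.injective e)

theorem relReflection_mul_self {r : ℕ} (hr : 1 ≤ r) (i : Fin (r + 1)) :
    relReflection r (rep r i) * relReflection r (rep r i) = 1 := by
  have h := (realizes_relPerm hr i).mul (realizes_relPerm hr i)
  have : (relPerm hr i ∘ relPerm hr i : ℤ → ℤ) = id :=
    funext fun x => relFun_involutive hr (Nat.lt_succ_iff.1 i.2) x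
  rw [this] at h
  exact h.eq (Realizes.one r)

/-- Inverting `w` turns left multiplication by `𝐫_i` into precomposition with the swap of `i` and
`rightEnd r i`, which flips the sign; right multiplication by `𝐫_j` becomes postcomposition, the
setting of `relFun_comm`. -/
theorem isSignSystem {r : ℕ} (hr : 1 ≤ r) :
    IsSignSystem (fun i : Fin (r + 1) => relReflection r (rep r i)) (realizable r)
      (fun i w => IsPos r i w⁻¹) where
  mem i := ⟨relPerm hr i, relPerm_isSymmetric hr i, realizes_relPerm hr i⟩
  sq := relReflection_mul_self hr
  one i := by
    rw [inv_one, Realizes.isPos_iff (f := 1) (Realizes.one r)]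
    exact lt_rightEnd (Nat.lt_succ_iff.1 i.2)
  anti i w hw h := by
    obtain ⟨f, hf, h'⟩ := (realizable r).inv_mem hw
    have hi := Nat.lt_succ_iff.1 i.2
    rw [mul_inv_rev, inv_eq_of_mul_eq_one_left (relReflection_mul_self hr i),
      Realizes.isPos_iff (f := f * relPerm hr i) (h'.mul (realizes_relPerm hr i))]
    rw [h'.isPos_iff] at h
    simp only [Equiv.Perm.mul_apply, relPerm_apply, relFun_left hi, relFun_right hr hi]
    exact h.not_gt
  exchange i j w hw h hn := by
    obtain ⟨f, hf, h'⟩ := (realizable r).inv_mem hw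
    have hi := Nat.lt_succ_iff.1 i.2
    have hj := Nat.lt_succ_iff.1 j.2
    rw [mul_inv_rev, inv_eq_of_mul_eq_one_left (relReflection_mul_self hr j),
      Realizes.isPos_iff (f := relPerm hr j * f) ((realizes_relPerm hr j).mul h')] at hn
    rw [h'.isPos_iff] at h
    simp only [Equiv.Perm.mul_apply, relPerm_apply, not_lt] at hn
    have key := relFun_comm hr hi hj hf h hn
    have e1 := h'.mul (realizes_relPerm hr i)
    have e2 := (realizes_relPerm hr j).mul h'
    have e3 : w⁻¹ * relReflection r (rep r i) = relReflection r (rep r j) * w⁻¹ := by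
      refine e1.eq ?_
      rwa [show (f ∘ relPerm hr i : ℤ → ℤ) = relPerm hr j ∘ f from key]
    calc _ = w * (w⁻¹ * relReflection r (rep r i)) * w := by group
      _ = _ := by rw [e3]; group

/-! ## The words of the translations -/

/-- The word `a, a + 1, …, b`. -/
def upList (r a b : ℕ) : List (Fin (r + 1)) :=
  (List.finRange (r + 1)).filter fun i : Fin (r + 1) => a ≤ (i : ℕ) ∧ (i : ℕ) ≤ b

theorem mem_upList {r a b : ℕ} {i : Fin (r + 1)} :
    i ∈ upList r a b ↔ a ≤ (i : ℕ) ∧ (i : ℕ) ≤ b := by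
  simp [upList]

theorem pairwise_upList (r a b : ℕ) : (upList r a b).Pairwise (· < ·) :=
  (List.pairwise_lt_finRange _).filter _

theorem upList_concat {r a b : ℕ} (ha : a ≤ b + 1) (hb : b + 1 ≤ r) :
    upList r a (b + 1) = upList r a b ++ [⟨b + 1, Nat.lt_succ_iff.2 hb⟩] := by
  refine List.Pairwise.eq_of_mem_iff (r := (· < ·)) (pairwise_upList _ _ _) ?_ fun i => ?_
  · rw [List.pairwise_append]
    refine ⟨pairwise_upList _ _ _, List.pairwise_singleton _ _, fun x hx y hy => ?_⟩
    rw [mem_upList] at hx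
    rw [List.mem_singleton] at hy
    rw [hy, Fin.lt_def]
    exact Nat.lt_succ_iff.2 hx.2
  · rw [List.mem_append, List.mem_singleton, mem_upList, mem_upList, Fin.ext_iff]
    simp only
    omega

theorem upList_cons {r a b : ℕ} (ha : a ≤ b) (hb : b ≤ r) :
    upList r a b = ⟨a, by omega⟩ :: upList r (a + 1) b := by
  refine List.Pairwise.eq_of_mem_iff (r := (· < ·)) (pairwise_upList _ _ _) ?_ fun i => ?_
  · rw [List.pairwise_cons]
    refine ⟨fun x hx => ?_, pairwise_upList _ _ _⟩
    rw [mem_upList] at hx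
    rw [Fin.lt_def]
    exact hx.1
  · rw [List.mem_cons, mem_upList, mem_upList, Fin.ext_iff]
    simp only
    omega

theorem upList_eq_nil {r a b : ℕ} (h : b < a) : upList r a b = [] := by
  rw [List.eq_nil_iff_forall_not_mem]
  intro i hi
  rw [mem_upList] at hi
  omega

theorem length_upList {r a b : ℕ} (hb : b ≤ r) : (upList r a b).length = b + 1 - a := by
  induction h : b + 1 - a generalizing a with
  | zero => rw [upList_eq_nil (by omega)]; rfl
  | succ n ih => rw [upList_cons (by omega) hb, List.length_cons, ih (by omega)]

/-- The product of a word in the permutations `relPerm`. -/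
def permProd {r : ℕ} (hr : 1 ≤ r) (l : List (Fin (r + 1))) : Equiv.Perm ℤ :=
  (l.map (relPerm hr)).prod

section

variable {r : ℕ} (hr : 1 ≤ r)

theorem permProd_append (l l' : List (Fin (r + 1))) :
    permProd hr (l ++ l') = permProd hr l * permProd hr l' := by
  simp [permProd]

theorem permProd_singleton_apply (i : Fin (r + 1)) (x : ℤ) :
    permProd hr [i] x = relFun r i x := by
  simp [permProd, relPerm_apply]

theorem permProd_replicate (p : ℕ) (l : List (Fin (r + 1))) :
    permProd hr (List.replicate p l).flatten = permProd hr l ^ p := by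
  induction p with
  | zero => simp [permProd]
  | succ p ih => rw [List.replicate_succ, List.flatten_cons, permProd_append, ih, pow_succ']

theorem isSymmetric_permProd (l : List (Fin (r + 1))) : IsSymmetric r (permProd hr l) := by
  induction l with
  | nil => exact IsSymmetric.id r
  | cons i l ih =>
    simp only [permProd, List.map_cons, List.prod_cons]
    exact (relPerm_isSymmetric hr i).comp ih

theorem realizes_permProd (l : List (Fin (r + 1))) :
    Realizes r (permProd hr l) (l.map fun i => relReflection r (rep r i)).prod := by
  induction l with
  | nil => exact Realizes.one r
  | cons i l ih =>
    simp only [permProd, List.map_cons, List.prod_cons]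
    exact (realizes_relPerm hr i).mul ih

theorem prod_eq_prod {l l' : List (Fin (r + 1))}
    (h : ∀ x : ℤ, 1 ≤ x → x ≤ r → permProd hr l x = permProd hr l' x) :
    (l.map fun i => relReflection r (rep r i)).prod =
      (l'.map fun i => relReflection r (rep r i)).prod := by
  have := (isSymmetric_permProd hr l).ext_window (isSymmetric_permProd hr l') h
  have h' := realizes_permProd hr l
  rw [this] at h'
  exact h'.eq (realizes_permProd hr l')

/-- Each letter of the word `l` increases the length when one starts with the permutation `f`. -/
def PosFrom : Equiv.Perm ℤ → List (Fin (r + 1)) → Prop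
  | _, [] => True
  | f, i :: l => f (i : ℕ) < f (rightEnd r i) ∧ PosFrom (f * relPerm hr i) l

theorem posFrom_append (f : Equiv.Perm ℤ) (l l' : List (Fin (r + 1))) :
    PosFrom hr f (l ++ l') ↔ PosFrom hr f l ∧ PosFrom hr (f * permProd hr l) l' := by
  induction l generalizing f with
  | nil => simp [PosFrom, permProd]
  | cons i l ih => simp [PosFrom, ih, and_assoc, permProd, mul_assoc]

theorem posFrom_singleton (f : Equiv.Perm ℤ) (i : Fin (r + 1)) :
    PosFrom hr f [i] ↔ f (i : ℕ) < f (rightEnd r i) := by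
  simp [PosFrom]

theorem isReducedWord_of_posFrom {l : List (Fin (r + 1))} (h : PosFrom hr 1 l) :
    IsReducedWord (fun i : Fin (r + 1) => relReflection r (rep r i)) l := by
  induction l using List.reverseRecOn with
  | nil => exact fun l' _ => Nat.zero_le _
  | append_singleton l i ih =>
    rw [posFrom_append, posFrom_singleton, one_mul] at h
    refine (isSignSystem hr).isReducedWord_concat (ih h.1) ?_
    rw [inv_inv, (realizes_permProd hr l).isPos_iff]
    exact h.2

/-! ### Values on the window `1, …, r` -/

theorem relFun_window {i : ℕ} (hi : i < r) {x : ℤ} (h₀ : 1 ≤ x) (h₁ : x ≤ r) :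
    relFun r i x = if x = i then x + 1 else if x = i + 1 then x - 1 else x := by
  have c1 := node_intCast_inj (r := r) (x := x) (y := i) (by omega) (by omega)
  have c2 := node_intCast_inj (r := r) (x := x) (y := i + 1) (by omega) (by omega)
  have c3 := node_intCast_inj (r := r) (x := x) (y := -i) (by omega) (by omega)
  have c4 := node_intCast_inj (r := r) (x := x) (y := 1 - i) (by omega) (by omega)
  push_cast at c1 c2 c3 c4
  simp only [relFun, hi, if_true, c1, c2, c3, c4]
  split_ifs <;> omega

theorem relFun_last_window {x : ℤ} (h₀ : 1 ≤ x) (h₁ : x ≤ r) :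
    relFun r r x = if x = r then (r : ℤ) + 2 else x := by
  have c1 := node_intCast_inj (r := r) (x := x) (y := r) (by omega) (by omega)
  have c2 := node_intCast_inj (r := r) (x := x) (y := r + 2) (by omega) (by omega)
  push_cast at c1 c2
  simp only [relFun, lt_irrefl, if_false, c1, c2]
  split_ifs <;> omega

end

section

variable {r : ℕ} (hr : 1 ≤ r)

/-! ### Ascending words, affine cycles and their powers. -/

theorem permProd_upList_concat {a b : ℕ} (ha : a ≤ b + 1) (hb : b + 1 ≤ r) (x : ℤ) :
    permProd hr (upList r a (b + 1)) x = permProd hr (upList r a b) (relFun r (b + 1) x) := by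
  rw [upList_concat ha hb, permProd_append, Equiv.Perm.mul_apply, permProd_singleton_apply]

theorem permProd_upList_zero {b : ℕ} (hb : b < r) {x : ℤ} (h₀ : 1 ≤ x) (h₁ : x ≤ r) :
    permProd hr (upList r 0 b) x = if x ≤ b then x + 1 else if x = b + 1 then 0 else x := by
  induction b generalizing x with
  | zero =>
    rw [upList_cons le_rfl (by omega), upList_eq_nil (by omega), permProd_singleton_apply,
      relFun_window hb h₀ h₁]
    split_ifs <;> push_cast at * <;> omega
  | succ b ih =>
    rw [permProd_upList_concat hr (by omega) hb.le, relFun_window hb h₀ h₁]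
    push_cast
    split_ifs <;> rw [ih (by omega) (by omega) (by omega)] <;> split_ifs <;> omega

theorem permProd_upList_one {b : ℕ} (hb : b < r) {x : ℤ} (h₀ : 1 ≤ x) (h₁ : x ≤ r) :
    permProd hr (upList r 1 b) x = if x ≤ b then x + 1 else if x = b + 1 then 1 else x := by
  induction b generalizing x with
  | zero =>
    rw [upList_eq_nil (by omega)]
    simp only [permProd, List.map_nil, List.prod_nil, Equiv.Perm.one_apply]
    split_ifs <;> push_cast at * <;> omega
  | succ b ih =>
    rw [permProd_upList_concat hr (by omega) hb.le, relFun_window hb h₀ h₁]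
    push_cast
    split_ifs <;> rw [ih (by omega) (by omega) (by omega)] <;> split_ifs <;> omega

/-- The word `0, 1, …, r - 1, r, r - 1, …, k`. -/
def cycleWord (r k : ℕ) : List (Fin (r + 1)) := upList r 0 r ++ (upList r k (r - 1)).reverse

theorem cycleWord_self (hr : 1 ≤ r) : cycleWord r r = upList r 0 r := by
  rw [cycleWord, upList_eq_nil (show r - 1 < r by omega)]; simp

theorem cycleWord_eq_concat {k : ℕ} (hk : k < r) :
    cycleWord r k = cycleWord r (k + 1) ++ [⟨k, by omega⟩] := by
  rw [cycleWord, upList_cons (a := k) (by omega) (by omega), List.reverse_cons, ← List.append_assoc,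
    cycleWord]

theorem length_cycleWord (hr : 1 ≤ r) {k : ℕ} (hk : k ≤ r) :
    (cycleWord r k).length = r + 1 + (r - k) := by
  rw [cycleWord, List.length_append, List.length_reverse, length_upList le_rfl,
    length_upList (by omega)]
  omega

theorem upList_zero_last (hr : 1 ≤ r) : upList r 0 r = upList r 0 (r - 1) ++ [⟨r, by omega⟩] := by
  obtain ⟨s, rfl⟩ : ∃ s, r = s + 1 := ⟨r - 1, by omega⟩
  exact upList_concat (by omega) le_rfl

/-- Descending induction from `k = r`: the extra last letter `k` exchanges `k` and `k + 1` first,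
which removes `k + 1` from the cycle. -/
theorem permProd_cycleWord {k : ℕ} (h1 : 1 ≤ k) (hk : k ≤ r) {x : ℤ} (h₀ : 1 ≤ x) (h₁ : x ≤ r) :
    permProd hr (cycleWord r k) x = if x < k then x + 1 else if x = k then 2 * r + 2 else x := by
  induction hk using Nat.decreasingInduction generalizing x with
  | self =>
    rw [cycleWord_self hr, upList_zero_last hr, permProd_append, Equiv.Perm.mul_apply,
      permProd_singleton_apply, relFun_last_window h₀ h₁]
    have hw : ∀ {y : ℤ}, 1 ≤ y → y ≤ r → permProd hr (upList r 0 (r - 1)) y =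
        if y < r then y + 1 else 0 := fun h h' => by
      rw [permProd_upList_zero hr (by omega) h h']
      split_ifs <;> omega
    rcases h₁.lt_or_eq with hlt | rfl
    · rw [if_neg hlt.ne, hw h₀ h₁, if_pos hlt, if_pos hlt]
    · rw [if_pos rfl, if_neg (lt_irrefl _), if_pos rfl,
        -- The letter `r` sends `r` out of the window to `r + 2`, which the two symmetries bring
        -- back to `r`.
        show (r + 2 : ℤ) = (1 - r) + (2 * r + 1) by ring, (isSymmetric_permProd hr _).add_period,
        (isSymmetric_permProd hr _).one_sub, hw h₀ le_rfl, if_neg (lt_irrefl _)]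
      ring
  | of_succ k hk ih =>
    rw [cycleWord_eq_concat hk, permProd_append, Equiv.Perm.mul_apply, permProd_singleton_apply,
      relFun_window hk h₀ h₁]
    simp only [Nat.cast_add, Nat.cast_one] at ih
    split_ifs <;> rw [ih (by omega) (by omega) (by omega)] <;> split_ifs <;> omega

theorem permProd_cycleWord_pow {k : ℕ} (h1 : 1 ≤ k) (hk : k ≤ r) {p : ℕ} (hp : p ≤ k) {x : ℤ}
    (h₀ : 1 ≤ x) (h₁ : x ≤ r) :
    (permProd hr (cycleWord r k) ^ p) x =
      if x + p ≤ k then x + p else if x ≤ k then x + p - k + (2 * r + 1) else x := by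
  induction p generalizing x with
  | zero => simp; omega
  | succ p ih =>
    have ih' : ∀ {y : ℤ}, 1 ≤ y → y ≤ r → _ := fun {y} => ih (x := y) (by omega)
    rw [pow_succ, Equiv.Perm.mul_apply, permProd_cycleWord hr h1 hk h₀ h₁,
      Nat.cast_add, Nat.cast_one]
    by_cases c1 : x < k
    · rw [if_pos c1, ih' (by omega) (by omega)]
      split_ifs <;> omega
    · rw [if_neg c1]
      by_cases c2 : x = k
      · rw [if_pos c2, show (2 * r + 2 : ℤ) = 1 + (2 * r + 1) by ring, ← permProd_replicate,
          (isSymmetric_permProd hr _).add_period, permProd_replicate, ih' (by omega) (by omega)]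
        split_ifs <;> omega
      · rw [if_neg c2, ih' h₀ h₁]
        split_ifs <;> omega

/-- The word `(0, 1, …, r - 1, r, r - 1, …, k)^k`. -/
def varpiWord (r k : ℕ) : List (Fin (r + 1)) := (List.replicate k (cycleWord r k)).flatten

theorem permProd_varpiWord {k : ℕ} (h1 : 1 ≤ k) (hk : k ≤ r) {x : ℤ} (h₀ : 1 ≤ x) (h₁ : x ≤ r) :
    permProd hr (varpiWord r k) x = if x ≤ k then x + (2 * r + 1) else x := by
  rw [varpiWord, permProd_replicate, permProd_cycleWord_pow hr h1 hk le_rfl h₀ h₁]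
  split_ifs <;> omega

/-! ### Reducedness -/

/-- Before a letter `b ≥ 1` is read, the prefix sends `b` to `0` and, for `b < r`, fixes `b + 1`;
then `f 0 = 1 - f 1 ≤ 0` lies below the value of `f` at `b + 1`. -/
theorem posFrom_upList_zero {f : Equiv.Perm ℤ} (hf : IsSymmetric r f)
    (hpos : ∀ x : ℤ, 1 ≤ x → x ≤ r → 1 ≤ f x) {b : ℕ} (hb : b ≤ r) :
    PosFrom hr f (upList r 0 b) := by
  induction b with
  | zero =>
    rw [upList_cons le_rfl hb, upList_eq_nil (by omega), posFrom_singleton]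
    have e : rightEnd r 0 = 1 := by
      rw [rightEnd, if_pos (by omega)]; rfl
    have h0 := hf.one_sub 1
    have h1 := hpos 1 le_rfl (by omega)
    simp only [e, Nat.cast_zero]
    rw [sub_self] at h0
    omega
  | succ b ih =>
    rw [upList_concat (by omega) hb, posFrom_append, posFrom_singleton]
    refine ⟨ih (by omega), ?_⟩
    have h0 := hf.one_sub 1
    have h1 := hpos 1 le_rfl (by omega)
    rw [sub_self] at h0
    simp only [Equiv.Perm.mul_apply]
    rw [permProd_upList_zero hr (by omega) (by push_cast; omega) (by omega),
      if_neg (by push_cast; omega), if_pos (by push_cast; rfl)]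
    unfold rightEnd
    split_ifs with hlt
    · rw [permProd_upList_zero hr (by omega) (by omega) (by omega), if_neg (by push_cast; omega),
        if_neg (by omega)]
      have := hpos ((b + 1 : ℕ) + 1) (by omega) (by omega)
      omega
    -- At the last letter the right end `r + 2` is carried to `1 + (2r + 1)`.
    · obtain rfl : r = b + 1 := by omega
      rw [show (((b + 1 : ℕ) : ℤ) + 2) = (1 - (b + 1 : ℕ)) + (2 * (b + 1 : ℕ) + 1) by ring,
        (isSymmetric_permProd hr _).add_period, (isSymmetric_permProd hr _).one_sub,
        permProd_upList_zero hr (by omega) (by push_cast; omega) (by omega),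
        if_neg (by push_cast; omega), if_pos (by push_cast; rfl), sub_zero, hf.add_period]
      omega

/-- A descending letter `k` compares `f (k + 1) = k + 1` with `f (2r + 2) = f 1 + (2r + 1) ≥ 2r +
2`. -/
theorem posFrom_cycleWord {f : Equiv.Perm ℤ} (hf : IsSymmetric r f) {k : ℕ}
    (h1 : 1 ≤ k) (hk : k ≤ r)
    (hpos : ∀ x : ℤ, 1 ≤ x → x ≤ r → 1 ≤ f x) (hfix : ∀ x : ℤ, k < x → x ≤ r → f x = x) :
    PosFrom hr f (cycleWord r k) := by
  induction hk using Nat.decreasingInduction with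
  | self =>
    rw [cycleWord_self hr]
    exact posFrom_upList_zero hr hf hpos le_rfl
  | of_succ k hk ih =>
    rw [cycleWord_eq_concat hk, posFrom_append, posFrom_singleton]
    refine ⟨ih (by omega) fun x hx => hfix x (by push_cast at hx; omega), ?_⟩
    simp only [Equiv.Perm.mul_apply, rightEnd, if_pos hk]
    rw [permProd_cycleWord hr (by omega) hk (by omega) (by omega),
      permProd_cycleWord hr (by omega) hk (by omega) (by omega), if_pos (by push_cast; omega),
      if_neg (by push_cast; omega), if_pos (by push_cast; rfl), hfix _ (by omega) (by omega),
      show (2 * r + 2 : ℤ) = 1 + (2 * r + 1) by ring, hf.add_period]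
    have := hpos 1 le_rfl (by omega)
    omega

theorem isReducedWord_varpiWord (hr : 1 ≤ r) {k : ℕ} (h1 : 1 ≤ k) (hk : k ≤ r) :
    IsReducedWord (fun i : Fin (r + 1) => relReflection r (rep r i)) (varpiWord r k) := by
  apply isReducedWord_of_posFrom hr
  -- Every power of the cycle with exponent below `k` keeps the window positive and fixes the points
  -- beyond `k`, so the next copy of the word can be appended.
  have key : ∀ p ≤ k, PosFrom hr 1 (List.replicate p (cycleWord r k)).flatten := by
    intro p hp
    induction p with
    | zero => simp [PosFrom]
    | succ p ih =>
      rw [List.replicate_succ', List.flatten_append, posFrom_append]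
      refine ⟨ih (by omega), ?_⟩
      have e : ([cycleWord r k] : List _).flatten = cycleWord r k := by simp
      rw [e, one_mul]
      have hval : ∀ {x : ℤ}, 1 ≤ x → x ≤ r →
          permProd hr (List.replicate p (cycleWord r k)).flatten x =
            if x + p ≤ k then x + p else if x ≤ k then x + p - k + (2 * r + 1) else x :=
        fun h h' => by
          rw [permProd_replicate, permProd_cycleWord_pow hr h1 hk (by omega) h h']
      refine posFrom_cycleWord hr (isSymmetric_permProd hr _) h1 hk (fun x h h' => ?_)
        fun x h h' => ?_
      · rw [hval h h']; split_ifs <;> omega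
      · rw [hval (by omega) h', if_neg (by omega), if_neg (by omega)]
  exact key k le_rfl

/-! ### The translations -/

theorem varpi_apply (r : ℕ) (i : Node r) (x : RootLattice r) :
    varpi r i x = x - (x i + x (-i) - 2 * x 0) • delta r := by
  have h : ∀ j, (fundamentalWeight r j).1 x = x j - x 0 := fun j => rfl
  have hd : ∀ j, (fundamentalWeight r j).1 (delta r) = 0 := fun j => (fundamentalWeight r j).2
  rw [varpi, LinearEquiv.mul_apply, translation_apply, translation_apply, map_sub, map_smul, hd, h,
    h, tau]
  module

/-- The involution `τ` on the lattice corresponds to `a ↦ 1 - a` on indices. -/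
theorem rootVec_one_sub (r : ℕ) (a : ℤ) (j : Node r) :
    rootVec r (1 - a) j + rootVec r a (-j) = rootVec r 1 j := by
  obtain ⟨c, hc⟩ := eq_add_const_of_step (F := fun a => rootVec r (1 - a) j)
    (G := fun a => -rootVec r a (-j)) fun a => by
      have e1 := congrFun (rootVec_add_one r (1 - (a + 1))) j
      have e2 := congrFun (rootVec_add_one r a) (-j)
      rw [show 1 - (a + 1) + 1 = 1 - a by ring] at e1
      have e3 : simpleRoot r ((1 - (a + 1) : ℤ) : Node r) j = simpleRoot r (a : Node r) (-j) := by
        simp only [simpleRoot, Pi.single_apply]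
        push_cast
        refine if_congr ⟨fun h => ?_, fun h => ?_⟩ rfl rfl
        · rw [h]; ring
        · rw [← h]; ring
      simp only [Pi.add_apply] at e1 e2
      rw [e1, e2, e3]; ring
  have h0 := hc 0
  have ha := hc a
  simp only [sub_zero] at h0 ha
  have z : rootVec r 0 (-j) = 0 := by
    simp only [rootVec, sub_zero, neg_eq_zero]
    exact Int.ediv_eq_zero_of_lt (by omega) (by exact_mod_cast ZMod.val_lt (-j))
  rw [ha, h0, z]; ring

theorem rootVec_window {a : ℤ} (h₀ : 1 ≤ a) (h₁ : a ≤ r) (j : Node r) :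
    rootVec r a j = if (j.val : ℤ) < a then 1 else 0 := by
  have hj : (j.val : ℤ) < 2 * r + 1 := by exact_mod_cast ZMod.val_lt j
  simp only [rootVec]
  split_ifs with h
  · rw [((Int.ediv_emod_unique (q := -1) (r := j.val - a + (2 * r + 1)) (by omega)).2
      ⟨by ring, by omega, by omega⟩).1]
    rfl
  · rw [Int.ediv_eq_zero_of_lt (by omega) (by omega)]
    rfl

theorem realizes_varpi {k : ℕ} (h1 : 1 ≤ k) (hk : k ≤ r) :
    Realizes r (permProd hr (varpiWord r k)) (varpi r (k : Node r)) := by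
  -- Subtracting a multiple of `δ` shifts the index of `rootVec` by that many periods. The summand
  -- `1`, balanced by the constant `delta r` in `Realizes`, makes `q (1 - a) = -q a`, as symmetry
  -- requires.
  set q : ℤ → ℤ := fun a =>
    rootVec r a k + rootVec r a (-k) - 2 * rootVec r a 0 + 1 with hq
  have hv : ((k : Node r)).val = k := ZMod.val_natCast_of_lt (by omega)
  have hv' : ((-k : Node r)).val = 2 * r + 1 - k := by
    have : NeZero (k : Node r) := ⟨fun h => by rw [h, ZMod.val_zero] at hv; omega⟩
    rw [ZMod.val_neg_of_ne_zero, hv]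
  have hw : ∀ x : ℤ, 1 ≤ x → x ≤ r → q x = if x ≤ k then -1 else 0 := fun x h h' => by
    simp only [hq, rootVec_window h h', hv, hv', ZMod.val_zero]
    push_cast [show k ≤ 2 * r + 1 by omega]
    split_ifs <;> omega
  have hsym : IsSymmetric r fun a => a + (-q a) * (2 * r + 1) := by
    refine ⟨fun a => ?_, fun a => ?_⟩
    · have : q (a + (2 * r + 1)) = q a := by
        simp only [hq, rootVec_add_period, Pi.add_apply, delta_apply]; ring
      simp only [this]; ring
    · have : q (1 - a) = - q a := by
        have e1 := rootVec_one_sub r a k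
        have e2 := rootVec_one_sub r a (-k)
        have e3 := rootVec_one_sub r a 0
        rw [neg_neg] at e2
        rw [neg_zero] at e3
        rw [rootVec_window le_rfl (by omega)] at e1 e2 e3
        rw [hv, if_neg (by omega)] at e1
        rw [hv', if_neg (by omega)] at e2
        rw [ZMod.val_zero, if_pos (by omega)] at e3
        simp only [hq]
        linarith
      simp only [this]; ring
  rw [(isSymmetric_permProd hr _).ext_window hsym fun x h h' => by
    rw [permProd_varpiWord hr h1 hk h h', hw x h h']
    split_ifs <;> ring]
  refine ⟨delta r, fun a => ?_⟩
  rw [varpi_apply, rootVec_add_mul_period]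
  simp only [hq]
  module

theorem prod_varpiWord (hr : 1 ≤ r) {k : ℕ} (h1 : 1 ≤ k) (hk : k ≤ r) :
    ((varpiWord r k).map fun i => relReflection r (rep r i)).prod = varpi r (k : Node r) :=
  (realizes_permProd hr _).eq (realizes_varpi hr h1 hk)

theorem varpi_mem_relativeWeylGroup (hr : 1 ≤ r) {k : ℕ} (h1 : 1 ≤ k) (hk : k ≤ r) :
    varpi r (k : Node r) ∈ relativeWeylGroup r := by
  refine Subgroup.mem_inf.2 ⟨?_, ?_⟩
  · rw [← prod_varpiWord hr h1 hk]
    refine Subgroup.list_prod_mem _ fun x hx => ?_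
    obtain ⟨i, -, rfl⟩ := List.mem_map.1 hx
    exact relReflection_mem_affineWeylGroup r _
  · have ht : ∀ (x : RootLattice r) j, tauLattice r x j = x (-j) := fun x j => rfl
    have hd : tauLattice r (delta r) = delta r := by
      ext j; rw [ht, delta_apply, delta_apply]
    rw [Subgroup.mem_centralizer_singleton_iff]
    refine LinearEquiv.ext fun x => ?_
    rw [LinearEquiv.mul_apply, LinearEquiv.mul_apply, varpi_apply, varpi_apply, map_sub, map_smul,
      hd, ht, ht, ht, neg_neg, neg_zero, add_comm (x (-k : Node r))]

end

/-! ## Lifts to the braid group -/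

/-- A homomorphism `φ` carries the braid relations to the `T i`, so Matsumoto's theorem applies. The
identity gives the ibraid group, an action gives the automorphisms. -/
theorem isLift_of_isReducedWord {r : ℕ} (hr : 1 ≤ r) {G : Type*} [Group G] (φ : IBraidGroup r →* G)
    {T : Fin (r + 1) → G} (hT : ∀ i, T i = φ (braidGen r i)) {l : List (Fin (r + 1))}
    (hl : IsReducedWord (fun i : Fin (r + 1) => relReflection r (rep r i)) l)
    {w : RootLattice r ≃ₗ[ℤ] RootLattice r}
    (hw : (l.map fun i => relReflection r (rep r i)).prod = w) :
    IsLift r T w (l.map T).prod := by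
  have hb : ∀ (f : FreeGroup (Fin (r + 1)) →* G), (∀ i, f (FreeGroup.of i) = T i) → ∀ i j m,
      f (altProd (FreeGroup.of i) (FreeGroup.of j) m) = altProd (T i) (T j) m := by
    intro f hf i j m
    induction m generalizing i j with
    | zero => exact map_one f
    | succ m ih => rw [altProd, map_mul, ih, hf]; rfl
  refine ⟨⟨l, hw, fun l' hl' => hl l' (hl'.trans hw.symm)⟩, fun l' ⟨h1, h2⟩ => ?_⟩
  refine (isSignSystem hr).prod_eq_of_isReducedWord T (fun i j => ?_) hl
    (fun m hm => h2 m (hm.trans h1)) (hw.trans h1.symm)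
  have hf : ∀ i, (φ.comp (PresentedGroup.mk (braidRelations r))) (FreeGroup.of i) = T i :=
    fun i => (hT i).symm
  rw [← hb _ hf, ← hb _ hf, ← mul_inv_eq_one, ← map_inv, ← map_mul, MonoidHom.comp_apply,
    PresentedGroup.one_of_mem (rels := braidRelations r) ⟨i, j, _, rfl, rfl⟩, map_one]

theorem prod_map_cycleWord {r : ℕ} {G : Type*} [Group G] (T : Fin (r + 1) → G) (k : ℕ) :
    ((cycleWord r k).map T).prod = prodUp T 0 r * prodDown T (r - 1) k := by
  rw [cycleWord, List.map_append, List.prod_append]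
  rfl

theorem prod_map_flatten_replicate {ι G : Type*} [Monoid G] (T : ι → G) (p : ℕ) (l : List ι) :
    ((List.replicate p l).flatten.map T).prod = (l.map T).prod ^ p := by
  induction p with
  | zero => simp
  | succ p ih => rw [List.replicate_succ, List.flatten_cons, List.map_append, List.prod_append, ih,
      pow_succ']

theorem isLift_varpi {r : ℕ} (hr : 1 ≤ r) {G : Type*} [Group G] (φ : IBraidGroup r →* G)
    {T : Fin (r + 1) → G} (hT : ∀ i, T i = φ (braidGen r i)) {k : ℕ} (h1 : 1 ≤ k) (hk : k ≤ r) :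
    IsLift r T (varpi r (k : Node r)) ((prodUp T 0 r * prodDown T (r - 1) k) ^ k) := by
  have := isLift_of_isReducedWord hr φ hT (isReducedWord_varpiWord hr h1 hk)
    (prod_varpiWord hr h1 hk)
  rwa [varpiWord, prod_map_flatten_replicate, prod_map_cycleWord] at this

theorem isLift_varpi_pred {r : ℕ} (h2 : 2 ≤ r) {G : Type*} [Group G] (φ : IBraidGroup r →* G)
    {T : Fin (r + 1) → G} (hT : ∀ i, T i = φ (braidGen r i)) :
    IsLift r T (varpi r ((r - 1 : ℕ) : Node r))
      (prodUp T 0 r ^ (r - 1) * prodUp T 1 (r - 1)) := by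
  have hr : 1 ≤ r := by omega
  set l := (List.replicate (r - 1) (upList r 0 r)).flatten ++ upList r 1 (r - 1) with hl
  have hprod : (l.map fun i => relReflection r (rep r i)).prod =
      ((varpiWord r (r - 1)).map fun i => relReflection r (rep r i)).prod := by
    refine prod_eq_prod hr fun x h₀ h₁ => ?_
    rw [permProd_varpiWord hr (by omega) (by omega) h₀ h₁, hl, permProd_append,
      Equiv.Perm.mul_apply, permProd_upList_one hr (by omega) h₀ h₁, permProd_replicate,
      ← cycleWord_self hr]
    split_ifs <;> rw [permProd_cycleWord_pow hr hr le_rfl (by omega) (by omega) (by omega)] <;>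
      split_ifs <;> omega
  -- Both lengths equal `(r - 1)(r + 2)`; minimality then passes from `varpiWord` to `l`.
  have hlen : l.length = (varpiWord r (r - 1)).length := by
    rw [hl, varpiWord, List.length_append, length_upList (by omega)]
    simp only [List.length_flatten, List.map_replicate, List.sum_replicate, smul_eq_mul,
      length_upList le_rfl, length_cycleWord hr (show r - 1 ≤ r by omega)]
    obtain ⟨s, rfl⟩ : ∃ s, r = s + 1 := ⟨r - 1, by omega⟩
    simp only [Nat.add_sub_cancel]
    rw [show s + 1 - s = 1 by omega, Nat.sub_zero]
    ring
  have hred : IsReducedWord (fun i : Fin (r + 1) => relReflection r (rep r i)) l := by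
    intro m hm
    rw [hlen]
    exact isReducedWord_varpiWord hr (by omega) (by omega) m (hm.trans hprod)
  have := isLift_of_isReducedWord hr φ hT hred
    (hprod.trans (prod_varpiWord hr (by omega) (by omega)))
  rw [hl, List.map_append, List.prod_append, prod_map_flatten_replicate] at this
  exact this

theorem isLift_varpi_all {r : ℕ} (hr : 1 ≤ r) {G : Type*} [Group G] (φ : IBraidGroup r →* G)
    {T : Fin (r + 1) → G} (hT : ∀ i, T i = φ (braidGen r i)) :
    (∀ k : ℕ, 1 ≤ k → k ≤ r →
        IsLift r T (varpi r (k : Node r)) ((prodUp T 0 r * prodDown T (r - 1) k) ^ k)) ∧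
      IsLift r T (varpi r ((1 : ℕ) : Node r)) (prodUp T 0 r * prodDown T (r - 1) 1) ∧
      (2 ≤ r → IsLift r T (varpi r ((r - 1 : ℕ) : Node r))
        (prodUp T 0 r ^ (r - 1) * prodUp T 1 (r - 1))) ∧
      IsLift r T (varpi r (r : Node r)) (prodUp T 0 r ^ r) := by
  refine ⟨fun k h1 hk => isLift_varpi hr φ hT h1 hk, ?_, fun h2 => isLift_varpi_pred h2 φ hT, ?_⟩
  · simpa using isLift_varpi hr φ hT le_rfl hr
  · have := isLift_varpi hr φ hT hr le_rfl
    rwa [← prod_map_cycleWord, cycleWord_self hr] at this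

end IBraid

open IBraid in
/-- For `1 ≤ k ≤ r`, `T_{ϖ_k} = (T_0 T_1 ⋯ T_{r-1} T_r T_{r-1} ⋯ T_k)^k`, together with the special
forms for `k = 1, r - 1, r`, in the ibraid group itself and for the automorphisms `𝐓_i` by
which it acts on the iquantum group. -/
theorem proposition2p6 (r : ℕ) (hr : 1 ≤ r) :
    (∀ k : ℕ, 1 ≤ k → k ≤ r → varpi r (k : Node r) ∈ relativeWeylGroup r) ∧
    -- in the ibraid group
    ((∀ k : ℕ, 1 ≤ k → k ≤ r →
        IsLift r (braidGen r) (varpi r (k : Node r))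
          ((prodUp (braidGen r) 0 r * prodDown (braidGen r) (r - 1) k) ^ k)) ∧
      IsLift r (braidGen r) (varpi r ((1 : ℕ) : Node r))
        (prodUp (braidGen r) 0 r * prodDown (braidGen r) (r - 1) 1) ∧
      (2 ≤ r → IsLift r (braidGen r) (varpi r ((r - 1 : ℕ) : Node r))
        (prodUp (braidGen r) 0 r ^ (r - 1) * prodUp (braidGen r) 1 (r - 1))) ∧
      IsLift r (braidGen r) (varpi r (r : Node r)) (prodUp (braidGen r) 0 r ^ r)) ∧
    -- for the automorphisms of the iquantum group
    (∀ Φ : IBraidGroup r →* (IQuantumGroup r ≃ₐ[Scalar] IQuantumGroup r), IsIBraidAction r Φ →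
      ∀ T : Fin (r + 1) → (IQuantumGroup r ≃ₐ[Scalar] IQuantumGroup r),
        (∀ i, T i = Φ (braidGen r i)) →
      (∀ k : ℕ, 1 ≤ k → k ≤ r →
        IsLift r T (varpi r (k : Node r)) ((prodUp T 0 r * prodDown T (r - 1) k) ^ k)) ∧
      IsLift r T (varpi r ((1 : ℕ) : Node r)) (prodUp T 0 r * prodDown T (r - 1) 1) ∧
      (2 ≤ r → IsLift r T (varpi r ((r - 1 : ℕ) : Node r))
        (prodUp T 0 r ^ (r - 1) * prodUp T 1 (r - 1))) ∧
      IsLift r T (varpi r (r : Node r)) (prodUp T 0 r ^ r)) :=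
  ⟨fun _ h1 hk => varpi_mem_relativeWeylGroup hr h1 hk,
    isLift_varpi_all hr (MonoidHom.id _) fun _ => rfl,
    fun Φ _ _ hT => isLift_varpi_all hr Φ hT⟩
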